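/- For $m\in\mathbb N$ let $[m]=\{0,\dots,m-1\}$. A function $f\colon X\to\mathbb R$ on $X=[3]\times[n]\subset\mathbb R^2$ is convex if $f(\sum_i\lambda_i x_i)\le\sum_i\lambda_i f(x_i)$ for every finite collection $x_1,\dots,x_k\in X$ and all $\lambda_i\ge 0$ with $\sum_i\lambda_i=1$ and $\sum_i\lambda_i x_i\in X$. For a probability distribution $\mathcal D$ on $X$, $g\colon X\to\mathbb R$ is $\varepsilon$-far from convex with respect to $\mathcal D$ if $\Pr_{x\sim\mathcal D}[g(x)\neq h(x)]\ge\varepsilon$ for every convex $h\colon X\to\mathbb R$; it is $\varepsilon$-far from convex if this holds for the uniform distribution. A (randomized, possibly adaptive) algorithm queries the values of an unknown function $f$ at points of $X$ and, in the distribution-free model, draws independent samples from an unknown distribution $\mathcal D$ on $X$; numbers of queries and samples are counted in the worst case. It is non-adaptive if it selects all the points to query before observing the value of $f$ at any of them. (1) There is an absolute constant $C>0$ such that for all $n\ge 2$ and $0<\varepsilon<1$ there is an algorithm that makes at most $C\,\frac{\log^2 n}{\varepsilon}$ queries to $f$ and draws at most $\frac{C}{\varepsilon}$ samples from $\mathcal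 D$ and that, for every distribution $\mathcal D$ on $[3]\times[n]$, accepts every convex $f\colon[3]\times[n]\to\mathbb R$ with probability $1$ and rejects every $f\colon[3]\times[n]\to\mathbb R$ that is $\varepsilon$-far from convex with respect to $\mathcal D$ with probability at least $\frac23$. (2) There is an absolute constant $c>0$ such that for all $n\ge 1$ and $0<\varepsilon\le\frac1{10}$, every non-adaptive algorithm that accepts every convex $f\colon[3]\times[n]\to\mathbb R$ with probability at least $\frac23$ and rejects every $f\colon[3]\times[n]\to\mathbb R$ that is $\varepsilon$-far from convex with probability at least $\frac23$ makes at least $c\sqrt n$ queries in the worst case. -/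

import Mathlib

open scoped ENNReal

namespace ConvexityTesting

/-! ### Convexity on a discrete set -/

/-- A function `f` on a set `X` of points of a real vector space `V` (given through the position
map `p : X → V`) is convex if `f (∑ λᵢ xᵢ) ≤ ∑ λᵢ f (xᵢ)` for every finite collection of points
`x₁, …, x_k` of `X` and every convex combination of them that is again a point of `X`. -/
def ConvexAt {V X : Type} [AddCommGroup V] [Module ℝ V] (p : X → V) (f : X → ℝ) : Prop :=
  ∀ (k : ℕ) (x : Fin k → X) (c : Fin k → ℝ) (z : X),
    (∀ i, 0 ≤ c i) → ∑ i, c i = 1 → ∑ i, c i • p (x i) = p z →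
      f z ≤ ∑ i, c i * f (x i)

/-- The stripe `[3] × [n]`, where `[m] = {0, 1, …, m - 1}`. -/
abbrev Stripe (n : ℕ) : Type := Fin 3 × Fin n

/-- The position of a point of the stripe in the plane. -/
def Stripe.pos {n : ℕ} (a : Stripe n) : ℝ × ℝ := ((a.1 : ℕ), (a.2 : ℕ))

/-- Convexity of a function `f : [3] × [n] → ℝ`. -/
def IsConvex {n : ℕ} (f : Stripe n → ℝ) : Prop := ConvexAt Stripe.pos f

/-- `g` is `ε`-far from convex (with respect to the counting measure):
it differs from every convex function in at least an `ε` fraction of the points. -/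
def IsFar {n : ℕ} (ε : ℝ) (g : Stripe n → ℝ) : Prop :=
  ∀ h : Stripe n → ℝ, IsConvex h →
    ε * Fintype.card (Stripe n) ≤ ({x | h x ≠ g x}.ncard : ℝ)

/-- `g` is `ε`-far from convex with respect to the distribution `D`:
`Pr_{x ∼ D} [g x ≠ h x] ≥ ε` for every convex `h`. -/
def IsFarWrt {n : ℕ} (D : PMF (Stripe n)) (ε : ℝ) (g : Stripe n → ℝ) : Prop :=
  ∀ h : Stripe n → ℝ, IsConvex h →
    ENNReal.ofReal ε ≤ D.toOuterMeasure {x | g x ≠ h x}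

/-! ### Randomized query algorithms -/

/-- A randomized query algorithm for functions `X → ℝ`, as a (well-founded) decision tree.
It may stop and answer (`true` is "accept", `false` is "reject"), query the value of the unknown
function at a point of its choice and continue depending on the real number received, draw a
sample from the unknown distribution on `X` and continue depending on the point received, or use
internal randomness: draw a natural number from a distribution of its choice, and continue
depending on the outcome. -/
inductive Algorithm (X : Type) : Type
  | output (b : Bool) : Algorithm X
  | query (x : X) (next : ℝ → Algorithm X) : Algorithm X
  | sample (next : X → Algorithm X) : Algorithm X
  | random (μ : PMF ℕ) (next : ℕ → Algorithm X) : Algorithm X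

namespace Algorithm

variable {X : Type}

/-- The distribution of the answer of the algorithm when the unknown function is `f` and the
unknown distribution is `D`; samples and internal randomness are all independent. -/
noncomputable def run (D : PMF X) (f : X → ℝ) : Algorithm X → PMF Bool
  | output b => PMF.pure b
  | query x next => run D f (next (f x))
  | sample next => D.bind fun x => run D f (next x)
  | random μ next => μ.bind fun i => run D f (next i)

/-- The worst-case number of queries. -/
noncomputable def queries : Algorithm X → ℕ∞
  | output _ => 0
  | query _ next => 1 + ⨆ y, queries (next y)
  | sample next => ⨆ x, queries (next x)
  | random _ next => ⨆ i, queries (next i)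

/-- The worst-case number of samples. -/
noncomputable def samples : Algorithm X → ℕ∞
  | output _ => 0
  | query _ next => ⨆ y, samples (next y)
  | sample next => 1 + ⨆ x, samples (next x)
  | random _ next => ⨆ i, samples (next i)

/-- From now on the algorithm queries exactly the points of the list `l`, in this order, whatever
happens; the values received, and further randomness, can influence its answer only. -/
inductive QueriesExactly : List X → Algorithm X → Prop
  | output (b : Bool) : QueriesExactly [] (output b)
  | query (x : X) (l : List X) (next : ℝ → Algorithm X) (h : ∀ y, QueriesExactly l (next y)) :
      QueriesExactly (x :: l) (query x next)
  | sample (l : List X) (next : X → Algorithm X) (h : ∀ x, QueriesExactly l (next x)) :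
      QueriesExactly l (sample next)
  | random (l : List X) (μ : PMF ℕ) (next : ℕ → Algorithm X) (h : ∀ i, QueriesExactly l (next i)) :
      QueriesExactly l (random μ next)

/-- A non-adaptive algorithm selects (at random) all the points to query before it observes the
value of the function at any of them. -/
inductive NonAdaptive : Algorithm X → Prop
  | selected (l : List X) (A : Algorithm X) (h : QueriesExactly l A) : NonAdaptive A
  | sample (next : X → Algorithm X) (h : ∀ x, NonAdaptive (next x)) : NonAdaptive (sample next)
  | random (μ : PMF ℕ) (next : ℕ → Algorithm X) (h : ∀ i, NonAdaptive (next i)) :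
      NonAdaptive (random μ next)

end Algorithm

/-! ### Testers -/

/-- Bounded-error `ε`-tester for convexity on the stripe in the standard model: distance is
measured uniformly, convex functions are accepted and functions `ε`-far from convex are rejected,
each with probability at least `2/3`. Here the samples available to the algorithm are uniform
points of the stripe, so that they are no more than internal randomness. -/
def IsTester {n : ℕ} [NeZero n] (ε : ℝ) (A : Algorithm (Stripe n)) : Prop :=
  (∀ f : Stripe n → ℝ, IsConvex f →
    2 / 3 ≤ A.run (PMF.uniformOfFintype (Stripe n)) f true) ∧
  (∀ f : Stripe n → ℝ, IsFar ε f →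
    2 / 3 ≤ A.run (PMF.uniformOfFintype (Stripe n)) f false)

/-- Distribution-free `ε`-tester with 1-sided error for convexity on the stripe: whatever the
unknown distribution `D` is, convex functions are accepted with probability `1`, and functions
that are `ε`-far from convex with respect to `D` are rejected with probability at least `2/3`. -/
def IsOneSidedDistributionFreeTester {n : ℕ} (ε : ℝ) (A : Algorithm (Stripe n)) : Prop :=
  ∀ D : PMF (Stripe n),
    (∀ f : Stripe n → ℝ, IsConvex f → A.run D f true = 1) ∧
    (∀ f : Stripe n → ℝ, IsFarWrt D ε f → 2 / 3 ≤ A.run D f false)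

end ConvexityTesting

namespace ConvexityTesting

/-! Both halves rest on supporting planes: a function with an affine minorant touching it at every
point is convex, and if such minorants exist only on a subset, their maximum is a convex function
that agrees there (`exists_isConvex_of_support`).

Upper bound. Each sampled point is inspected by deterministic queries, and rejection happens only if
the answers fit no convex function, so the error is one-sided. It suffices that `f` agrees with one
convex function on all points that pass (`exists_isConvex_eq_of_passes`): the failing points of a
far function then have mass at least `ε`. Inspection reads the ends of all dyadic intervals around a
point of a column. Two points of a column share a pair of adjacent anchors between them, so the
slopes on both sides can be compared through a common slope, and local fits to different convex
functions glue together (`le_of_agree_anchors`). In an outer column the plane can be tilted steeply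
away from the rest of the stripe. In the middle column it must also pass below both outer columns;
binary search yields three candidates for its slope and tangent points, one of which always works
for a convex function (`IsConvex.exists_supportsMiddle`). This takes `O(log n)` queries per sample,
within the claimed `log² n`.

Lower bound. Shear the parabola `8 k²` by an unknown shift `r`, with `k = t - i r`, and perturb it
slightly. The parabola is so strongly curved that only the midpoint conditions on the triples `(0,
k)`, `(1, k + r)`, `(2, k + 2r)` matter. Digits in `{0, 1, 2}` encode the perturbation: a sum
congruent to `2` modulo `3` makes every condition hold, while a sum congruent to `1` violates one
condition per block of three values of `k`. Any two of the three residues of a block are uniform in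
both families, so only queries meeting all three columns of one block help (`exists_seed_shift`),
and `q` fixed queries do this for at most `5 q²` of the `n / 20` shifts (`card_reveals_le`). -/

/-! ### Convex functions on the stripe -/

/-- A function that is supported from below by an affine function at each point is convex. -/
theorem isConvex_of_support {n : ℕ} {f : Stripe n → ℝ}
    (H : ∀ z : Stripe n, ∃ α β γ : ℝ, f z ≤ α * (z.1 : ℕ) + β * (z.2 : ℕ) + γ ∧
      ∀ x : Stripe n, α * (x.1 : ℕ) + β * (x.2 : ℕ) + γ ≤ f x) : IsConvex f := by
  intro k x c z hc hsum hz
  obtain ⟨α, β, γ, h₁, h₂⟩ := H z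
  have e₁ := congrArg Prod.fst hz
  have e₂ := congrArg Prod.snd hz
  simp only [Prod.fst_sum, Prod.snd_sum, Stripe.pos, Prod.smul_fst, Prod.smul_snd,
    smul_eq_mul] at e₁ e₂
  calc f z ≤ α * (z.1 : ℕ) + β * (z.2 : ℕ) + γ := h₁
    _ = ∑ i, c i * (α * ((x i).1 : ℕ) + β * ((x i).2 : ℕ) + γ) := by
        rw [← e₁, ← e₂, Finset.mul_sum, Finset.mul_sum]
        conv_lhs => rw [← mul_one γ, ← hsum, Finset.mul_sum]
        rw [← Finset.sum_add_distrib, ← Finset.sum_add_distrib]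
        exact Finset.sum_congr rfl fun i _ => by ring
    _ ≤ _ := Finset.sum_le_sum fun i _ => mul_le_mul_of_nonneg_left (h₂ _) (hc i)

/-- The convexity inequality for three points, with weights that need not sum to `1`. -/
theorem IsConvex.le_three {n : ℕ} {f : Stripe n → ℝ} (hf : IsConvex f) (x y w z : Stripe n)
    {a b c : ℝ} (ha : 0 ≤ a) (hb : 0 ≤ b) (hc : 0 ≤ c) (hs : 0 < a + b + c)
    (h₁ : a * (x.1 : ℕ) + b * (y.1 : ℕ) + c * (w.1 : ℕ) = (a + b + c) * (z.1 : ℕ))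
    (h₂ : a * (x.2 : ℕ) + b * (y.2 : ℕ) + c * (w.2 : ℕ) = (a + b + c) * (z.2 : ℕ)) :
    (a + b + c) * f z ≤ a * f x + b * f y + c * f w := by
  have := hf 3 ![x, y, w] ![a / (a + b + c), b / (a + b + c), c / (a + b + c)] z
    (by intro i; fin_cases i <;> simp <;> positivity)
    (by simp [Fin.sum_univ_three]; field_simp)
    (by
      simp only [Fin.sum_univ_three, Stripe.pos]
      ext
      · simp
        field_simp
        linarith
      · simp
        field_simp
        linarith)
  simp only [Fin.sum_univ_three, Matrix.cons_val_zero, Matrix.cons_val_one, Matrix.cons_val] at this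
  have h3 := mul_le_mul_of_nonneg_left this hs.le
  refine h3.trans_eq ?_
  field_simp

/-! ### Functions hiding a shift -/

/-- The function `8 k² + η i k`, where `k = t - i r`, with a perturbation `η`. -/
noncomputable def shifted (n r : ℕ) (η : Fin 3 → ℤ → ℝ) (x : Stripe n) : ℝ :=
  8 * ((x.2 : ℕ) - (x.1 : ℕ) * (r : ℝ)) ^ 2 + η x.1 ((x.2 : ℕ) - (x.1 : ℕ) * (r : ℤ))

/-- The plane tangent to the parabola along `k = a` lies `8 (k - a)² ≥ 8` below it at all other
integers `k`, which absorbs perturbations of size `2`. Only the three points with `k = a` constrain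
the correction `e`, which has to be affine in the column. -/
theorem isConvex_shifted (n r : ℕ) {η : Fin 3 → ℤ → ℝ} (hη : ∀ i k, |η i k| ≤ 2)
    (h : ∀ k, 2 * η 1 k ≤ η 0 k + η 2 k) : IsConvex (shifted n r η) := by
  have key : ∀ (a : ℤ) (e : Fin 3 → ℝ), e 0 + e 2 = 2 * e 1 → (∀ i, e i ≤ η i a) →
      (∀ i, e i ≤ 6) → ∃ α β γ : ℝ, ∀ x : Stripe n,
        α * (x.1 : ℕ) + β * (x.2 : ℕ) + γ =
          8 * (2 * a * ((x.2 : ℕ) - (x.1 : ℕ) * (r : ℝ)) - a ^ 2) + e x.1 ∧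
        α * (x.1 : ℕ) + β * (x.2 : ℕ) + γ ≤ shifted n r η x := by
    intro a e he hea he6
    refine ⟨-16 * a * r + (e 1 - e 0), 16 * a, -8 * a ^ 2 + e 0, fun x => ?_⟩
    have eq : (-16 * a * r + (e 1 - e 0)) * (x.1 : ℕ) + 16 * a * (x.2 : ℕ) + (-8 * a ^ 2 + e 0) =
        8 * (2 * a * ((x.2 : ℕ) - (x.1 : ℕ) * (r : ℝ)) - a ^ 2) + e x.1 := by
      obtain ⟨i, t⟩ := x
      fin_cases i <;> simp <;> linarith
    refine ⟨eq, ?_⟩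
    rw [eq, shifted]
    set k : ℤ := (x.2 : ℕ) - (x.1 : ℕ) * (r : ℤ) with hk
    have hkr : ((x.2 : ℕ) : ℝ) - (x.1 : ℕ) * (r : ℝ) = k := by rw [hk]; push_cast; ring
    rw [hkr]
    by_cases hka : k = a
    · rw [hka]; linarith [hea x.1]
    · have h1 : (1 : ℝ) ≤ ((k : ℝ) - a) ^ 2 := by
        have : (1 : ℤ) ≤ (k - a) ^ 2 := by
          have : 0 < (k - a) ^ 2 := by have := sub_ne_zero.2 hka; positivity
          omega
        exact_mod_cast this
      have := neg_le_of_abs_le (hη x.1 k)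
      nlinarith [he6 x.1]
  apply isConvex_of_support
  intro z
  set k : ℤ := (z.2 : ℕ) - (z.1 : ℕ) * (r : ℤ) with hk
  have hkr : ((z.2 : ℕ) : ℝ) - (z.1 : ℕ) * (r : ℝ) = k := by rw [hk]; push_cast; ring
  suffices ∃ e : Fin 3 → ℝ, e 0 + e 2 = 2 * e 1 ∧ (∀ i, e i ≤ η i k) ∧ (∀ i, e i ≤ 6) ∧
      η z.1 k ≤ e z.1 by
    obtain ⟨e, h1, h2, h3, h4⟩ := this
    obtain ⟨α, β, γ, H⟩ := key k e h1 h2 h3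
    refine ⟨α, β, γ, ?_, fun x => (H x).2⟩
    rw [(H z).1, shifted, hkr, ← hk]
    linarith
  have b0 := abs_le.1 (hη 0 k)
  have b1 := abs_le.1 (hη 1 k)
  have b2 := abs_le.1 (hη 2 k)
  have h := h k
  obtain ⟨i, t⟩ := z
  fin_cases i
  -- At an outer column the affine correction descends through the minimal value `-2` in the middle,
  -- hence stays below every admissible perturbation.
  · refine ⟨![η 0 k, -2, -4 - η 0 k], by simp; ring, ?_, ?_, by simp⟩ <;>
      intro i <;> fin_cases i <;> simp <;> linarith
  · refine ⟨![η 0 k, η 1 k, 2 * η 1 k - η 0 k], by simp, ?_, ?_, by simp⟩ <;>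
      intro i <;> fin_cases i <;> simp <;> linarith
  · refine ⟨![-4 - η 2 k, -2, η 2 k], by simp; ring, ?_, ?_, by simp⟩ <;>
      intro i <;> fin_cases i <;> simp <;> linarith

/-- The seeds of the perturbation: two free residues modulo `3` for each block of three
consecutive values of `k`. -/
abbrev Seed (n : ℕ) : Type := (Fin n → ZMod 3) × (Fin n → ZMod 3)

/-- The three residues of a block: two free ones, and a third that makes their sum `c`. -/
def residue {n : ℕ} [NeZero n] (c : ZMod 3) (ω : Seed n) (i : Fin 3) (g : ℕ) : ZMod 3 :=
  ![ω.1 (Fin.ofNat n g), ω.2 (Fin.ofNat n g),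
    c - ω.1 (Fin.ofNat n g) - ω.2 (Fin.ofNat n g)] i

/-- The digit in `{0, 1, 2}` that determines the perturbation at `(i, k)`. -/
def digit {n : ℕ} [NeZero n] (c : ZMod 3) (ω : Seed n) (i : Fin 3) (k : ℤ) : ℕ :=
  if k < 0 then 1 else (residue c ω i (k.toNat / 3) + (k.toNat : ZMod 3)).val

theorem digit_le {n : ℕ} [NeZero n] (c : ZMod 3) (ω : Seed n) (i : Fin 3) (k : ℤ) :
    digit c ω i k ≤ 2 := by
  unfold digit
  split_ifs
  · omega
  · exact Nat.le_of_lt_succ (ZMod.val_lt _)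

/-- The perturbation determined by a seed. -/
noncomputable def perturbation {n : ℕ} [NeZero n] (c : ZMod 3) (ω : Seed n) (i : Fin 3) (k : ℤ) :
    ℝ :=
  if i = 1 then 1 - digit c ω i k / 2 else digit c ω i k

theorem abs_perturbation_le {n : ℕ} [NeZero n] (c : ZMod 3) (ω : Seed n) (i : Fin 3) (k : ℤ) :
    |perturbation c ω i k| ≤ 2 := by
  have h : (digit c ω i k : ℝ) ≤ 2 := by exact_mod_cast digit_le c ω i k
  have h0 : (0 : ℝ) ≤ digit c ω i k := Nat.cast_nonneg _
  unfold perturbation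
  split_ifs <;> rw [abs_le] <;> constructor <;> linarith

/-- Adding `k` to each of three residues does not change their sum modulo `3`, so the digit sum is
`2` or `5`; for negative `k` it is `3`. -/
theorem two_le_digit_sum {n : ℕ} [NeZero n] (ω : Seed n) (k : ℤ) :
    2 ≤ digit 2 ω 0 k + digit 2 ω 1 k + digit 2 ω 2 k := by
  unfold digit
  split_ifs
  · omega
  · simp only [residue, Matrix.cons_val_zero, Matrix.cons_val_one, Matrix.cons_val]
    generalize ω.1 _ = u
    generalize ω.2 _ = v
    generalize (k.toNat : ZMod 3) = w
    revert u v w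
    decide

/-- Within a block each column takes the digits `0, 1, 2` once, so the three digit sums add up to
`9`. Each is `1` or `4`, hence exactly one of them is `1`. -/
theorem exists_digit_sum_eq_one {n : ℕ} [NeZero n] (ω : Seed n) (g : ℕ) :
    ∃ k : ℕ, k / 3 = g ∧ digit 1 ω 0 k + digit 1 ω 1 k + digit 1 ω 2 k = 1 := by
  have key : ∀ u v : ZMod 3, ∃ j : Fin 3, (u + ((j : ℕ) : ZMod 3)).val +
      (v + ((j : ℕ) : ZMod 3)).val + (1 - u - v + ((j : ℕ) : ZMod 3)).val = 1 := by decide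
  obtain ⟨j, hj⟩ := key (ω.1 (Fin.ofNat n g)) (ω.2 (Fin.ofNat n g))
  have hk : (3 * g + (j : ℕ)) / 3 = g := by omega
  refine ⟨3 * g + j, hk, ?_⟩
  have h3 : ((3 * g + (j : ℕ) : ℕ) : ZMod 3) = ((j : ℕ) : ZMod 3) := by
    push_cast
    rw [show (3 : ZMod 3) = 0 from rfl]; ring
  have hn : ¬ ((3 * g + (j : ℕ) : ℕ) : ℤ) < 0 := by omega
  simp only [digit, if_neg hn, Int.toNat_natCast, hk, h3, residue, Matrix.cons_val_zero,
    Matrix.cons_val_one, Matrix.cons_val]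
  exact hj

theorem isConvex_shifted_perturbation {n : ℕ} [NeZero n] (r : ℕ) (ω : Seed n) :
    IsConvex (shifted n r (perturbation 2 ω)) := by
  refine isConvex_shifted n r (abs_perturbation_le 2 ω) fun k => ?_
  have : (2 : ℝ) ≤ digit 2 ω 0 k + digit 2 ω 1 k + digit 2 ω 2 k := by
    exact_mod_cast two_le_digit_sum ω k
  simp only [perturbation]
  simp
  linarith

/-- A digit sum of `1` violates midpoint convexity on the triple of that `k`, so a convex function
must change a value in each block. Distinct blocks involve distinct points. -/
theorem isFar_shifted_perturbation {n : ℕ} [NeZero n] {r : ℕ} (hr : r < n / 20) (ω : Seed n)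
    {ε : ℝ} (hε : ε ≤ 1 / 10) : IsFar ε (shifted n r (perturbation 1 ω)) := by
  intro h hh
  set f := shifted n r (perturbation 1 ω) with hf
  have key : ∀ g < (n - 2 * r) / 3, ∃ x : Stripe n, h x ≠ f x ∧ ((x.2 : ℕ) - x.1 * r) / 3 = g := by
    intro g hg
    obtain ⟨k, hk, hs⟩ := exists_digit_sum_eq_one ω g
    by_contra! hcon
    have hlt : ∀ i : Fin 3, k + i * r < n := by
      intro i
      have : (i : ℕ) * r ≤ 2 * r := Nat.mul_le_mul_right _ (by omega)
      omega
    have heq : ∀ i : Fin 3, h (i, ⟨k + i * r, hlt i⟩) = f (i, ⟨k + i * r, hlt i⟩) := by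
      intro i
      by_contra hne
      exact hcon _ hne (by simp [hk])
    have hval : ∀ i : Fin 3, f (i, ⟨k + i * r, hlt i⟩) = 8 * k ^ 2 + perturbation 1 ω i k := by
      intro i
      simp [hf, shifted]
    have := hh.le_three (0, ⟨k + (0 : Fin 3) * r, hlt 0⟩) (2, ⟨k + (2 : Fin 3) * r, hlt 2⟩)
      (1, ⟨k + (1 : Fin 3) * r, hlt 1⟩) (1, ⟨k + (1 : Fin 3) * r, hlt 1⟩) (a := 1) (b := 1) (c := 0)
      (by norm_num) (by norm_num) le_rfl (by norm_num) (by norm_num) (by push_cast; norm_num; ring)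
    rw [heq, heq, heq, hval, hval, hval] at this
    have hs' : (digit 1 ω 0 k : ℝ) + digit 1 ω 1 k + digit 1 ω 2 k = 1 := by exact_mod_cast hs
    simp [perturbation] at this
    linarith
  have hcard : (n - 2 * r) / 3 ≤ {x | h x ≠ f x}.ncard := by
    have hsub : (Finset.range ((n - 2 * r) / 3) : Set ℕ) ⊆
        (fun x : Stripe n => ((x.2 : ℕ) - x.1 * r) / 3) '' {x | h x ≠ f x} := by
      intro g hg
      obtain ⟨x, hx, hxg⟩ := key g (by simpa using hg)
      exact ⟨x, hx, hxg⟩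
    have h1 := Set.ncard_le_ncard hsub (Set.toFinite _)
    rw [Set.ncard_coe_finset, Finset.card_range] at h1
    exact h1.trans (Set.ncard_image_le (Set.toFinite _))
  -- `r < n / 20` gives `n - 2 r ≥ 9 n / 10 + 2`, and the `2` pays for rounding in the division by
  -- `3`.
  have h10 : 3 * n ≤ 10 * ((n - 2 * r) / 3) := by omega
  have h10' : (3 * n : ℝ) ≤ 10 * ({x | h x ≠ f x}.ncard : ℝ) := by
    exact_mod_cast h10.trans (Nat.mul_le_mul_left 10 hcard)
  simp only [Fintype.card_prod, Fintype.card_fin]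
  push_cast
  have hn : (0 : ℝ) ≤ n := Nat.cast_nonneg n
  nlinarith

/-- A function which is far from convex for simple reasons. -/
theorem isFar_indicator {n : ℕ} {ε : ℝ} (hε : ε ≤ 1 / 10) :
    IsFar ε (fun x : Stripe n => if x.1 = 1 then (1 : ℝ) else 0) := by
  intro h hh
  have key : ∀ t : Fin n, ∃ i : Fin 3, h (i, t) ≠ if i = 1 then (1 : ℝ) else 0 := by
    intro t
    by_contra! hcon
    have := hh.le_three (0, t) (2, t) (1, t) (1, t) (a := 1) (b := 1) (c := 0)
      (by norm_num) (by norm_num) le_rfl (by norm_num) (by norm_num) (by ring)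
    rw [hcon, hcon, hcon, if_pos rfl, if_neg (by decide), if_neg (by decide)] at this
    norm_num at this
  have hcard : n ≤ {x : Stripe n | h x ≠ if x.1 = 1 then (1 : ℝ) else 0}.ncard := by
    have hsub : (Set.univ : Set (Fin n)) ⊆
        Prod.snd '' {x : Stripe n | h x ≠ if x.1 = 1 then (1 : ℝ) else 0} := by
      intro t _
      obtain ⟨i, hi⟩ := key t
      exact ⟨(i, t), hi, rfl⟩
    have h1 := Set.ncard_le_ncard hsub (Set.toFinite _)
    rw [Set.ncard_univ, Nat.card_fin] at h1
    exact h1.trans (Set.ncard_image_le (Set.toFinite _))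
  have hcard' : (n : ℝ) ≤ _ := Nat.cast_le.2 hcard
  simp only [Fintype.card_prod, Fintype.card_fin]
  push_cast
  have hn : (0 : ℝ) ≤ n := Nat.cast_nonneg n
  refine le_trans ?_ hcard'
  nlinarith

/-! ### Indistinguishability -/

/-- The shift `r` is revealed by the queries in `l` if these meet all three columns of one of the
blocks. -/
def Reveals {n : ℕ} (l : List (Stripe n)) (r : ℕ) : Prop :=
  ∃ g : ℕ, ∀ i : Fin 3, ∃ x ∈ l, x.1 = i ∧ (i : ℕ) * r ≤ x.2 ∧ ((x.2 : ℕ) - i * r) / 3 = g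

-- Columns `0` and `1` already suffice: if `x` and `y` lie in the same block, then `y - r` and `x`
-- differ by at most `2`, so each pair of queries leaves five possible shifts.
open Classical in
theorem card_reveals_le {n : ℕ} (l : List (Stripe n)) (R : ℕ) :
    ((Finset.range R).filter (Reveals l)).card ≤ 5 * l.length ^ 2 := by
  have hsub : (Finset.range R).filter (Reveals l) ⊆
      (l.toFinset ×ˢ l.toFinset ×ˢ Finset.range 5).image
        (fun p => (p.2.1.2 : ℕ) + 2 - p.1.2 - p.2.2) := by
    intro r hr
    obtain ⟨g, hg⟩ := (Finset.mem_filter.1 hr).2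
    obtain ⟨x, hx, hx0, hx1, hx2⟩ := hg 0
    obtain ⟨y, hy, hy0, hy1, hy2⟩ := hg 1
    simp only [Fin.val_zero, Fin.val_one, zero_mul, one_mul, Nat.sub_zero] at hx1 hx2 hy1 hy2
    rw [Finset.mem_image]
    refine ⟨(x, y, (y.2 : ℕ) + 2 - x.2 - r), ?_, ?_⟩
    · simp only [Finset.mem_product, List.mem_toFinset, Finset.mem_range]
      exact ⟨hx, hy, by omega⟩
    · simp only
      omega
  refine (Finset.card_le_card hsub).trans (Finset.card_image_le.trans ?_)
  rw [Finset.card_product, Finset.card_product, Finset.card_range]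
  have := l.toFinset_card_le
  nlinarith [Nat.mul_le_mul this this]

/-- If the shift is not revealed by `l`, then the two families of functions can be matched so that
matched functions agree on `l`. -/
theorem exists_seed_shift {n : ℕ} [NeZero n] {l : List (Stripe n)} {r : ℕ} (h : ¬ Reveals l r) :
    ∃ d : Seed n, ∀ ω : Seed n, ∀ x ∈ l,
      shifted n r (perturbation 1 ω) x = shifted n r (perturbation 2 (ω + d)) x := by
  unfold Reveals at h
  push Not at h
  choose i hi using h
  -- Passing from sum `1` to sum `2` changes a single residue of each block, the one in an unqueried
  -- column `i g`. If that is column `2`, the dependent residue absorbs the change and the seed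
  -- stays put.
  obtain ⟨d, hd₁, hd₂⟩ : ∃ d : Seed n, (∀ g, d.1 g = if i g = 0 then 1 else 0) ∧
      ∀ g, d.2 g = if i g = 1 then 1 else 0 :=
    ⟨(fun g => if i g = 0 then 1 else 0, fun g => if i g = 1 then 1 else 0),
      fun _ => rfl, fun _ => rfl⟩
  refine ⟨d, fun ω x hx => ?_⟩
  unfold shifted
  congr 1
  suffices digit 1 ω x.1 ((x.2 : ℕ) - (x.1 : ℕ) * (r : ℤ)) =
      digit 2 (ω + d) x.1 ((x.2 : ℕ) - (x.1 : ℕ) * (r : ℤ)) by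
    simp only [perturbation, this]
  unfold digit
  split_ifs with hneg
  · rfl
  · have hle : (x.1 : ℕ) * r ≤ x.2 := by
      have : ((x.1 : ℕ) * r : ℤ) ≤ (x.2 : ℕ) := by omega
      exact_mod_cast this
    have htn : (((x.2 : ℕ) : ℤ) - (x.1 : ℕ) * (r : ℤ)).toNat = x.2 - x.1 * r := by
      rw [← Nat.cast_mul]; omega
    rw [htn]
    set g := ((x.2 : ℕ) - x.1 * r) / 3 with hg
    have hgn : ((Fin.ofNat n g : Fin n) : ℕ) = g := by
      simp only [Fin.ofNat]
      exact Nat.mod_eq_of_lt (by omega)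
    have hne : i g ≠ x.1 := fun he => hi g x hx he.symm (he ▸ hle) (by rw [he])
    congr 2
    simp only [residue, Prod.fst_add, Prod.snd_add, Pi.add_apply, hd₁, hd₂, hgn]
    generalize i g = j at hne
    obtain ⟨a, t⟩ := x
    simp only at hne ⊢
    generalize ω.1 _ = u
    generalize ω.2 _ = v
    clear hg hgn hi htn hle hneg hx hd₁ hd₂
    revert hne j u v
    clear g
    revert a
    decide

namespace Algorithm

variable {X : Type}

theorem QueriesExactly.run_congr {l : List X} {A : Algorithm X} (h : QueriesExactly l A)
    (D : PMF X) {f g : X → ℝ} (hfg : ∀ x ∈ l, f x = g x) : A.run D f = A.run D g := by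
  induction h with
  | output b => rfl
  | query x l next h ih =>
    simp only [run]
    rw [hfg x (by simp), ih _ fun y hy => hfg y (by simp [hy])]
  | sample l next h ih =>
    simp only [run]
    congr 1
    funext x
    exact ih x hfg
  | random l μ next h ih =>
    simp only [run]
    congr 1
    funext x
    exact ih x hfg

theorem QueriesExactly.length_le_queries [Nonempty X] {l : List X} {A : Algorithm X}
    (h : QueriesExactly l A) : (l.length : ℕ∞) ≤ A.queries := by
  induction h with
  | output b => simp
  | query x l next h ih =>
    simp only [queries, List.length_cons]
    push_cast
    rw [add_comm]
    gcongr
    exact (ih 0).trans (le_iSup (fun y => queries (next y)) 0)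
  | sample l next h ih =>
    obtain ⟨x⟩ := ‹Nonempty X›
    exact (ih x).trans (le_iSup (fun y => queries (next y)) x)
  | random l μ next h ih =>
    exact (ih 0).trans (le_iSup (fun y => queries (next y)) 0)

theorem sum_bind_le {ι α : Type} [Fintype ι] (μ : PMF α) (P Q : ι → α → PMF Bool) (b : Bool)
    (B : ℝ≥0∞) (h : ∀ a, ∑ i, P i a b ≤ ∑ i, Q i a b + B) :
    ∑ i, (μ.bind (P i)) b ≤ ∑ i, (μ.bind (Q i)) b + B := by
  have swap : ∀ P : ι → α → PMF Bool, ∑ i, (μ.bind (P i)) b = ∑' a, μ a * ∑ i, P i a b := by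
    intro P
    simp only [PMF.bind_apply, Finset.mul_sum]
    rw [Summable.tsum_finsetSum fun _ _ => ENNReal.summable]
  rw [swap, swap]
  calc ∑' a, μ a * ∑ i, P i a b ≤ ∑' a, (μ a * ∑ i, Q i a b + μ a * B) := by
        refine ENNReal.tsum_le_tsum fun a => ?_
        rw [← mul_add]
        gcongr
        exact h a
    _ = _ := by rw [ENNReal.tsum_add, ENNReal.tsum_mul_right, μ.tsum_coe, one_mul]

/-- If no fixed list of at most `q` queries distinguishes the families `F` and `G` on average, then
no non-adaptive algorithm does so with `q` queries. -/
theorem NonAdaptive.sum_run_le {ι : Type} [Fintype ι] [Nonempty X] {A : Algorithm X}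
    (hA : A.NonAdaptive) (D : PMF X) (F G : ι → X → ℝ) (b : Bool) (B : ℝ≥0∞) {q : ℕ}
    (hB : ∀ (l : List X) (A : Algorithm X), QueriesExactly l A → l.length ≤ q →
      ∑ i, A.run D (F i) b ≤ ∑ i, A.run D (G i) b + B) (hq : A.queries ≤ q) :
    ∑ i, A.run D (F i) b ≤ ∑ i, A.run D (G i) b + B := by
  induction hA with
  | selected l A h => exact hB l A h (by exact_mod_cast h.length_le_queries.trans hq)
  | sample next h ih =>
    exact sum_bind_le D _ _ b B fun x =>
      ih x ((le_iSup (fun y => queries (next y)) x).trans hq)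
  | random μ next h ih =>
    exact sum_bind_le μ _ _ b B fun x =>
      ih x ((le_iSup (fun y => queries (next y)) x).trans hq)

end Algorithm

-- For an unrevealed shift, translating the seeds matches the two families run by run, so the
-- contributions agree. A revealed shift contributes at most the number of seeds.
open Classical in
theorem sum_run_shifted_le {n : ℕ} [NeZero n] (D : PMF (Stripe n)) (R : ℕ) {q : ℕ}
    {l : List (Stripe n)} {A : Algorithm (Stripe n)} (hA : A.QueriesExactly l)
    (hl : l.length ≤ q) :
    ∑ p : Fin R × Seed n, A.run D (shifted n p.1 (perturbation 1 p.2)) false ≤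
      ∑ p : Fin R × Seed n, A.run D (shifted n p.1 (perturbation 2 p.2)) false +
        ((5 * q ^ 2 * Fintype.card (Seed n) : ℕ) : ℝ≥0∞) := by
  have key : ∀ r : ℕ, ∑ ω : Seed n, A.run D (shifted n r (perturbation 1 ω)) false ≤
      ∑ ω : Seed n, A.run D (shifted n r (perturbation 2 ω)) false +
        if Reveals l r then (Fintype.card (Seed n) : ℝ≥0∞) else 0 := by
    intro r
    split_ifs with hr
    · refine le_add_left ?_
      refine (Finset.sum_le_sum fun ω _ => PMF.coe_le_one _ _).trans_eq ?_
      simp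
    · obtain ⟨d, hd⟩ := exists_seed_shift hr
      rw [add_zero, ← Equiv.sum_comp (Equiv.addRight d) fun ω : Seed n =>
        A.run D (shifted n r (perturbation 2 ω)) false]
      refine Finset.sum_le_sum fun ω _ => ?_
      rw [hA.run_congr D (hd ω)]
      rfl
  rw [Fintype.sum_prod_type, Fintype.sum_prod_type]
  refine (Finset.sum_le_sum fun (r : Fin R) _ => key r).trans ?_
  rw [Finset.sum_add_distrib]
  gcongr
  rw [Fin.sum_univ_eq_sum_range (fun r => if Reveals l r then (Fintype.card (Seed n) : ℝ≥0∞) else 0),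
    ← Finset.sum_filter, Finset.sum_const, nsmul_eq_mul]
  rw [← Nat.cast_mul]
  refine Nat.cast_le.2 (Nat.mul_le_mul_right _ ((card_reveals_le l R).trans ?_))
  gcongr

theorem run_false_le_third {X : Type} {D : PMF X} {f : X → ℝ} {A : Algorithm X}
    (h : 2 / 3 ≤ A.run D f true) : A.run D f false ≤ 1 / 3 := by
  have h1 := (A.run D f).tsum_coe
  rw [tsum_fintype, Fintype.sum_bool] at h1
  have h2 : (1 : ℝ≥0∞) = 2 / 3 + 1 / 3 := by
    rw [← ENNReal.add_div, show (2 : ℝ≥0∞) + 1 = 3 by norm_num]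
    exact (ENNReal.div_self (by norm_num) (by norm_num)).symm
  have hne : (2 / 3 : ℝ≥0∞) ≠ ⊤ := ENNReal.div_ne_top (by norm_num) (by norm_num)
  refine (ENNReal.add_le_add_iff_left hne).1 ?_
  rw [← h2, ← h1]
  gcongr

/-- Non-adaptive testers need many queries. -/
theorem queries_lower_bound {n : ℕ} [NeZero n] {ε : ℝ} (hε : ε ≤ 1 / 10)
    {A : Algorithm (Stripe n)} (hA : A.NonAdaptive) (hT : IsTester ε A) {q : ℕ}
    (hq : A.queries ≤ q) : 1 / 25 * Real.sqrt n ≤ q := by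
  set D := PMF.uniformOfFintype (Stripe n) with hD
  have h23 : (2 / 3 : ℝ≥0∞) = ((2 / 3 : NNReal) : ℝ≥0∞) := by
    rw [ENNReal.coe_div (by norm_num)]; norm_num
  have h13 : (1 / 3 : ℝ≥0∞) = ((1 / 3 : NNReal) : ℝ≥0∞) := by
    rw [ENNReal.coe_div (by norm_num)]; norm_num
  -- The main argument is void for `n < 20`, so algorithms without queries are excluded separately;
  -- this later absorbs the rounding in `n / 20`.
  have hq1 : 1 ≤ q := by
    by_contra! h0
    have h0 : q = 0 := by omega
    subst h0
    have := hA.sum_run_le D (ι := Unit) (fun _ x => if x.1 = 1 then (1 : ℝ) else 0) (fun _ _ => 0)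
      false 0 (q := 0) (fun l A hl hl0 => by
        have : l = [] := List.eq_nil_of_length_eq_zero (by omega)
        subst this
        rw [hl.run_congr D (g := fun _ => 0) (by simp), add_zero]) hq
    simp only [Finset.univ_unique, Finset.sum_const, Finset.card_singleton, one_smul,
      add_zero] at this
    have h1 := hT.2 _ (isFar_indicator hε)
    have h2 := run_false_le_third (hT.1 (fun _ => 0)
      (isConvex_of_support fun z => ⟨0, 0, 0, by simp, by simp⟩))
    have h3 := h1.trans (this.trans h2)
    rw [h23, h13, ENNReal.coe_le_coe] at h3
    exact absurd h3 (by rw [not_le, ← NNReal.coe_lt_coe]; push_cast; norm_num)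
  -- On average over shifts and seeds, `2/3 ≤ 1/3 + 5 q² / (n / 20)`.
  have hR : n / 20 ≤ 15 * q ^ 2 := by
    have h := hA.sum_run_le D (fun p : Fin (n / 20) × Seed n => shifted n p.1 (perturbation 1 p.2))
      (fun p => shifted n p.1 (perturbation 2 p.2)) false _
      (fun l A hl hlen => sum_run_shifted_le D (n / 20) hl hlen) hq
    have hlow : ∑ p : Fin (n / 20) × Seed n, (2 / 3 : ℝ≥0∞) ≤
        ∑ p : Fin (n / 20) × Seed n, A.run D (shifted n p.1 (perturbation 1 p.2)) false :=
      Finset.sum_le_sum fun p _ => hT.2 _ (isFar_shifted_perturbation p.1.2 p.2 hε)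
    have hup : ∑ p : Fin (n / 20) × Seed n, A.run D (shifted n p.1 (perturbation 2 p.2)) false ≤
        ∑ p : Fin (n / 20) × Seed n, (1 / 3 : ℝ≥0∞) :=
      Finset.sum_le_sum fun p _ =>
        run_false_le_third (hT.1 _ (isConvex_shifted_perturbation p.1 p.2))
    have h := hlow.trans (h.trans (add_le_add_left hup _))
    rw [Finset.sum_const, Finset.sum_const, Finset.card_univ, Fintype.card_prod, Fintype.card_fin,
      nsmul_eq_mul, nsmul_eq_mul, h23, h13] at h
    have hc : 0 < Fintype.card (Seed n) := Fintype.card_pos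
    set c := Fintype.card (Seed n)
    have h' : ((n / 20 * c : ℕ) : ℝ) * (2 / 3) ≤
        ((n / 20 * c : ℕ) : ℝ) * (1 / 3) + ((5 * q ^ 2 * c : ℕ) : ℝ) := by
      exact_mod_cast h
    have h'' : ((n / 20 * c : ℕ) : ℝ) ≤ ((15 * q ^ 2 * c : ℕ) : ℝ) := by
      have : ((15 * q ^ 2 * c : ℕ) : ℝ) = 3 * ((5 * q ^ 2 * c : ℕ) : ℝ) := by push_cast; ring
      rw [this]
      linarith
    exact Nat.le_of_mul_le_mul_right (by exact_mod_cast h'') hc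
  have hn : n ≤ 625 * q ^ 2 := by
    have : 1 ≤ q ^ 2 := Nat.one_le_pow _ _ hq1
    omega
  have hs : Real.sqrt n ≤ 25 * q := by
    rw [Real.sqrt_le_left (by positivity)]
    have : (n : ℝ) ≤ 625 * q ^ 2 := by exact_mod_cast hn
    nlinarith
  linarith

/-! ### Convex sequences -/

/-- Convexity of the finite sequence `g 0, …, g (n - 1)`. -/
def SeqConvex (n : ℕ) (g : ℕ → ℝ) : Prop :=
  ∀ a b c : ℕ, a ≤ b → b ≤ c → c < n → ((c : ℝ) - a) * g b ≤ (c - b) * g a + (b - a) * g c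

/-- `σ` is a subgradient of the sequence `g 0, …, g (n - 1)` at `t`. -/
def IsSubgradient (n : ℕ) (g : ℕ → ℝ) (t : ℕ) (σ : ℝ) : Prop :=
  ∀ x < n, g t + σ * (x - t) ≤ g x

/-- Slopes of a convex sequence increase, so comparison with the adjacent slopes is enough; at an
end of the range one condition is vacuous. -/
theorem SeqConvex.isSubgradient {n : ℕ} {g : ℕ → ℝ} (hg : SeqConvex n g) {t : ℕ} {σ : ℝ}
    (ht : t < n) (hl : 0 < t → g t - g (t - 1) ≤ σ) (hr : t + 1 < n → σ ≤ g (t + 1) - g t) :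
    IsSubgradient n g t σ := by
  intro x hx
  rcases lt_trichotomy x t with h | h | h
  · have h1 := hg x (t - 1) t (by omega) (by omega) ht
    have hl := hl (by omega)
    rw [Nat.cast_sub (by omega)] at h1
    have : (x : ℝ) < t := by exact_mod_cast h
    push_cast at h1
    nlinarith
  · rw [h]; simp
  · have h1 := hg t (t + 1) x (by omega) (by omega) hx
    have hr := hr (by omega)
    have : (t : ℝ) < x := by exact_mod_cast h
    push_cast at h1
    nlinarith

theorem SeqConvex.exists_isSubgradient {n : ℕ} {g : ℕ → ℝ} (hg : SeqConvex n g) {t : ℕ}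
    (ht : t < n) : ∃ σ, IsSubgradient n g t σ := by
  by_cases h : t + 1 < n
  · refine ⟨g (t + 1) - g t, hg.isSubgradient ht (fun h0 => ?_) fun _ => le_rfl⟩
    have h1 := hg (t - 1) t (t + 1) (by omega) (by omega) h
    rw [Nat.cast_sub (by omega)] at h1
    push_cast at h1
    linarith
  · exact ⟨g t - g (t - 1), hg.isSubgradient ht (fun _ => le_rfl) fun h' => absurd h' h⟩

theorem SeqConvex.le_of_le_succ {n : ℕ} {g : ℕ → ℝ} (hg : SeqConvex n g) {m x : ℕ}
    (h : g m ≤ g (m + 1)) (hmx : m < x) (hx : x < n) : g m ≤ g x := by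
  have h1 := hg m (m + 1) x (by omega) (by omega) hx
  have : (m : ℝ) < x := by exact_mod_cast hmx
  push_cast at h1
  nlinarith

theorem SeqConvex.le_of_succ_le {n : ℕ} {g : ℕ → ℝ} (hg : SeqConvex n g) {m x : ℕ}
    (h : g (m + 1) ≤ g m) (hmx : x ≤ m) (hm : m + 1 < n) : g (m + 1) ≤ g x := by
  have h1 := hg x m (m + 1) (by omega) (by omega) hm
  have : (x : ℝ) ≤ m := by exact_mod_cast hmx
  push_cast at h1
  nlinarith

theorem SeqConvex.sub_linear {n : ℕ} {g : ℕ → ℝ} (hg : SeqConvex n g) (σ : ℝ) :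
    SeqConvex n fun a => g a - σ * a := by
  intro a b c hab hbc hc
  have := hg a b c hab hbc hc
  simp only
  nlinarith

/-- The left slope at an optimal splitting `a + b = s` is at most a slope `σ` whose tangent points
satisfy `s < a' + b'`. -/
theorem left_slope_le {n : ℕ} {g g' : ℕ → ℝ} (hg : SeqConvex n g) (hg' : SeqConvex n g')
    {a b a' b' : ℕ} (ha : a < n) (ha' : a' < n) (hb' : b' < n)
    (opt : ∀ x y, x + y = a + b → x < n → y < n → g a + g' b ≤ g x + g' y) {σ : ℝ}
    (h : IsSubgradient n g a' σ) (h' : IsSubgradient n g' b' σ) (hlt : a + b < a' + b')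
    (h0 : 0 < a) : g a - g (a - 1) ≤ σ := by
  by_cases hle : a ≤ a'
  · have h1 := hg (a - 1) a a' (by omega) hle ha'
    have h2 := h (a - 1) (by omega)
    rw [Nat.cast_sub (by omega)] at h1 h2
    have : (a : ℝ) ≤ a' := by exact_mod_cast hle
    push_cast at h1 h2
    nlinarith
  -- Now `b < b'`. By optimality, moving one unit from `a` to `b` gains nothing, so the left slope
  -- of `g` is at most the right slope of `g'` at `b`, which is at most `σ`.
  · have h1 := hg' b (b + 1) b' (by omega) (by omega) hb'
    have h2 := h' b (by omega)
    have h3 := opt (a - 1) (b + 1) (by omega) (by omega) (by omega)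
    have : (b : ℝ) + 1 ≤ b' := by exact_mod_cast (by omega : b + 1 ≤ b')
    push_cast at h1 h2
    nlinarith

/-- The right slope at an optimal splitting `a + b = s` is at least a slope `σ` whose tangent points
satisfy `a' + b' < s`. -/
theorem le_right_slope {n : ℕ} {g g' : ℕ → ℝ} (hg : SeqConvex n g) (hg' : SeqConvex n g')
    {a b a' b' : ℕ} (hb : b < n)
    (opt : ∀ x y, x + y = a + b → x < n → y < n → g a + g' b ≤ g x + g' y) {σ : ℝ}
    (h : IsSubgradient n g a' σ) (h' : IsSubgradient n g' b' σ) (hlt : a' + b' < a + b)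
    (h0 : a + 1 < n) : σ ≤ g (a + 1) - g a := by
  by_cases hle : a' ≤ a
  · have h1 := hg a' a (a + 1) hle (by omega) h0
    have h2 := h (a + 1) (by omega)
    have : (a' : ℝ) ≤ a := by exact_mod_cast hle
    push_cast at h1 h2
    nlinarith
  · have h1 := hg' b' (b - 1) b (by omega) (by omega) hb
    have h2 := h' b (by omega)
    have h3 := opt (a + 1) (b - 1) (by omega) (by omega) (by omega)
    rw [Nat.cast_sub (by omega)] at h1
    have : (b' : ℝ) + 1 ≤ b := by exact_mod_cast (by omega : b' + 1 ≤ b)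
    push_cast at h1 h2
    nlinarith

theorem exists_between_finset (L U : Finset ℝ) (h : ∀ l ∈ L, ∀ u ∈ U, l ≤ u) :
    ∃ σ, (∀ l ∈ L, l ≤ σ) ∧ ∀ u ∈ U, σ ≤ u := by
  by_cases hL : L.Nonempty
  · exact ⟨L.max' hL, fun l hl => L.le_max' l hl, fun u hu => h _ (L.max'_mem hL) u hu⟩
  · rw [Finset.not_nonempty_iff_eq_empty] at hL
    subst hL
    by_cases hU : U.Nonempty
    · exact ⟨U.min' hU, by simp, fun u hu => U.min'_le u hu⟩
    · rw [Finset.not_nonempty_iff_eq_empty] at hU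
      subst hU
      exact ⟨0, by simp, by simp⟩

/-- Convex sequences have a common subgradient at given points as soon as no left slope exceeds a
right slope. -/
theorem exists_common_isSubgradient {n : ℕ} (G : Fin 3 → ℕ → ℝ) (hG : ∀ i, SeqConvex n (G i))
    (τ : Fin 3 → ℕ) (hτ : ∀ i, τ i < n)
    (h : ∀ i j, 0 < τ i → τ j + 1 < n →
      G i (τ i) - G i (τ i - 1) ≤ G j (τ j + 1) - G j (τ j)) :
    ∃ σ, ∀ i, IsSubgradient n (G i) (τ i) σ := by
  obtain ⟨σ, h1, h2⟩ := exists_between_finset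
    ((Finset.univ.filter fun i => 0 < τ i).image fun i => G i (τ i) - G i (τ i - 1))
    ((Finset.univ.filter fun i => τ i + 1 < n).image fun i => G i (τ i + 1) - G i (τ i))
    (by
      intro l hl u hu
      simp only [Finset.mem_image, Finset.mem_filter, Finset.mem_univ, true_and] at hl hu
      obtain ⟨i, hi, rfl⟩ := hl
      obtain ⟨j, hj, rfl⟩ := hu
      exact h i j hi hj)
  refine ⟨σ, fun i => (hG i).isSubgradient (hτ i) (fun h0 => h1 _ ?_) fun h0 => h2 _ ?_⟩ <;>
  · simp only [Finset.mem_image, Finset.mem_filter, Finset.mem_univ, true_and]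
    exact ⟨i, h0, rfl⟩

/-! ### Dyadic anchors -/

/-- The ends of the dyadic intervals that contain `t`, and their neighbours. -/
def anchors (K t : ℕ) : List ℕ :=
  (List.range K).flatMap fun k =>
    [t / 2 ^ k * 2 ^ k - 1, t / 2 ^ k * 2 ^ k, (t / 2 ^ k + 1) * 2 ^ k - 1, (t / 2 ^ k + 1) * 2 ^ k]

theorem length_anchors (K t : ℕ) : (anchors K t).length = 4 * K := by
  simp [anchors, mul_comm]

theorem mem_anchors {K t s : ℕ} : s ∈ anchors K t ↔ ∃ k < K, s = t / 2 ^ k * 2 ^ k - 1 ∨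
    s = t / 2 ^ k * 2 ^ k ∨ s = (t / 2 ^ k + 1) * 2 ^ k - 1 ∨ s = (t / 2 ^ k + 1) * 2 ^ k := by
  simp [anchors]

theorem self_mem_anchors {K t : ℕ} (hK : 0 < K) : t ∈ anchors K t :=
  mem_anchors.2 ⟨0, hK, by simp⟩

/-- At the coarsest level where the dyadic intervals of `x` and `y` differ they have the same
parent, so they are its two halves. -/
theorem exists_div_two_pow_succ {x y : ℕ} (h : x < y) (K : ℕ) (hK : x / 2 ^ K = y / 2 ^ K) :
    ∃ k < K, y / 2 ^ k = x / 2 ^ k + 1 := by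
  induction K with
  | zero => simp at hK; omega
  | succ K ih =>
    by_cases he : x / 2 ^ K = y / 2 ^ K
    · obtain ⟨k, hk, hk'⟩ := ih he
      exact ⟨k, by omega, hk'⟩
    · refine ⟨K, by omega, ?_⟩
      have := Nat.div_le_div_right (c := 2 ^ K) h.le
      rw [pow_succ, ← Nat.div_div_eq_div_mul, ← Nat.div_div_eq_div_mul] at hK
      omega

/-- Two points share two consecutive anchors that separate them. -/
theorem exists_common_anchors {K x y : ℕ} (h : x < y) (hy : y < 2 ^ K) :
    ∃ m, x ≤ m ∧ m + 1 ≤ y ∧ m ∈ anchors K x ∧ m + 1 ∈ anchors K x ∧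
      m ∈ anchors K y ∧ m + 1 ∈ anchors K y := by
  obtain ⟨k, hk, hxy⟩ := exists_div_two_pow_succ h K (by
    rw [Nat.div_eq_of_lt hy, Nat.div_eq_of_lt (h.trans hy)])
  have hpos : 0 < 2 ^ k := by positivity
  have h1 : 1 ≤ (x / 2 ^ k + 1) * 2 ^ k := Nat.one_le_iff_ne_zero.2 (by positivity)
  have h2 : x < (x / 2 ^ k + 1) * 2 ^ k := by
    rw [add_mul, one_mul]; exact Nat.lt_div_mul_add hpos
  have h3 : (x / 2 ^ k + 1) * 2 ^ k ≤ y := by rw [← hxy]; exact Nat.div_mul_le_self _ _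
  have h4 : (x / 2 ^ k + 1) * 2 ^ k - 1 + 1 = (x / 2 ^ k + 1) * 2 ^ k := by omega
  refine ⟨(x / 2 ^ k + 1) * 2 ^ k - 1, by omega, by omega, ?_, ?_, ?_, ?_⟩
  · exact mem_anchors.2 ⟨k, hk, by simp⟩
  · exact mem_anchors.2 ⟨k, hk, by simp [h4]⟩
  · exact mem_anchors.2 ⟨k, hk, by simp [hxy]⟩
  · exact mem_anchors.2 ⟨k, hk, by simp [hxy, h4]⟩

/-- If `F` agrees with a convex sequence on the anchors of `t`, and with another one on the anchors
of `x`, then the line through `t` with a subgradient as its slope passes below `x`. -/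
theorem le_of_agree_anchors {n K : ℕ} (hn : n ≤ 2 ^ K) {F g g' : ℕ → ℝ} {t x : ℕ} (ht : t < n)
    (hx : x < n) (hg : SeqConvex n g) (hg' : SeqConvex n g') (hF : ∀ s ∈ anchors K t, F s = g s)
    (hF' : ∀ s ∈ anchors K x, F s = g' s) {σ : ℝ} (hσ : IsSubgradient n g t σ) :
    F t + σ * (x - t) ≤ F x := by
  rcases lt_trichotomy t x with h | h | h
  · have hK : 0 < K := by
      by_contra! h0
      have : K = 0 := by omega
      subst this
      simp at hn
      omega
    obtain ⟨m, h1, h2, m1, m2, m3, m4⟩ := exists_common_anchors h (hx.trans_le hn)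
    rw [hF t (self_mem_anchors hK), hF' x (self_mem_anchors hK)]
    have e1 := (hF m m1).symm.trans (hF' m m3)
    have e2 := (hF _ m2).symm.trans (hF' _ m4)
    have c1 := hg t m (m + 1) h1 (by omega) (by omega)
    have c2 := hg' m (m + 1) x (by omega) h2 hx
    have s1 := hσ m (by omega)
    have s2 := hσ (m + 1) (by omega)
    rw [← e1, ← e2] at c2
    have i1 : (t : ℝ) ≤ m := by exact_mod_cast h1
    have i2 : (m : ℝ) + 1 ≤ x := by exact_mod_cast h2
    push_cast at c1 c2 s2
    -- The slope over `[m, m + 1]` is common to `g` and `g'`: it is at least `σ` by convexity of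
    -- `g`, and `g'` continues at least as steeply up to `x`.
    have hδ : σ ≤ g (m + 1) - g m := by
      rcases h1.eq_or_lt with h | h
      · subst h; linarith
      · have : (t : ℝ) < m := by exact_mod_cast h
        by_contra! hcon
        nlinarith
    nlinarith
  · rw [h]; simp
  · have hK : 0 < K := by
      by_contra! h0
      have : K = 0 := by omega
      subst this
      simp at hn
      omega
    obtain ⟨m, h1, h2, m1, m2, m3, m4⟩ := exists_common_anchors h (ht.trans_le hn)
    rw [hF t (self_mem_anchors hK), hF' x (self_mem_anchors hK)]
    have e1 := (hF m m3).symm.trans (hF' m m1)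
    have e2 := (hF _ m4).symm.trans (hF' _ m2)
    have c1 := hg m (m + 1) t (by omega) h2 ht
    have c2 := hg' x m (m + 1) h1 (by omega) (by omega)
    have s1 := hσ m (by omega)
    have s2 := hσ (m + 1) (by omega)
    rw [← e1, ← e2] at c2
    have i1 : (x : ℝ) ≤ m := by exact_mod_cast h1
    have i2 : (m : ℝ) + 1 ≤ t := by exact_mod_cast h2
    push_cast at c1 c2 s2
    have hδ : g (m + 1) - g m ≤ σ := by
      rcases h2.eq_or_lt with h | h
      · have : (t : ℝ) = m + 1 := by exact_mod_cast h.symm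
        rw [← h] at s1
        push_cast at s1
        linarith
      · have : (m : ℝ) + 1 < t := by exact_mod_cast h
        by_contra! hcon
        nlinarith
    nlinarith

/-! ### The columns of the stripe -/

/-- The point of the stripe in row `t`, or in the last row if there is no row `t`. -/
def point {n : ℕ} [NeZero n] (i : Fin 3) (t : ℕ) : Stripe n :=
  (i, ⟨min t (n - 1), by have := NeZero.pos n; omega⟩)

/-- A column of a function on the stripe. -/
def column {n : ℕ} [NeZero n] (f : Stripe n → ℝ) (i : Fin 3) (t : ℕ) : ℝ := f (point i t)

theorem point_val {n : ℕ} [NeZero n] (x : Stripe n) : point x.1 (x.2 : ℕ) = x := by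
  obtain ⟨i, t⟩ := x
  simp only [point, Prod.mk.injEq, true_and]
  ext
  simp
  omega

theorem point_snd {n : ℕ} [NeZero n] (i : Fin 3) {t : ℕ} (ht : t < n) :
    ((point i t : Stripe n).2 : ℕ) = t := by
  simp only [point]
  omega

theorem column_val {n : ℕ} [NeZero n] (f : Stripe n → ℝ) (x : Stripe n) :
    column f x.1 (x.2 : ℕ) = f x := by rw [column, point_val]

theorem IsConvex.seqConvex {n : ℕ} [NeZero n] {f : Stripe n → ℝ} (hf : IsConvex f) (i : Fin 3) :
    SeqConvex n (column f i) := by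
  intro a b c hab hbc hc
  rcases (hab.trans hbc).eq_or_lt with h | h
  · have : b = a := by omega
    subst this
    subst h
    simp
  have h1 : (a : ℝ) ≤ b := by exact_mod_cast hab
  have h2 : (b : ℝ) ≤ c := by exact_mod_cast hbc
  have h3 : (a : ℝ) < c := by exact_mod_cast h
  have := hf.le_three (point i a) (point i c) (point i c) (point i b) (a := c - b) (b := b - a)
    (c := 0) (by linarith) (by linarith) le_rfl (by linarith)
    (by simp only [point]; ring)
    (by rw [point_snd i (by omega), point_snd i (by omega), point_snd i (by omega)]; ring)
  simp only [column]
  linarith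

theorem IsConvex.middle_le {n : ℕ} [NeZero n] {f : Stripe n → ℝ} (hf : IsConvex f) {a b w y : ℕ}
    (ha : a < n) (hb : b < n) (hw : w < n) (hy : y < n) {d : ℝ} (hd : 0 ≤ d)
    (h : (a : ℝ) + b + d * w = (2 + d) * y) :
    (2 + d) * column f 1 y ≤ column f 0 a + column f 2 b + d * column f 1 w := by
  have := hf.le_three (point 0 a) (point 2 b) (point 1 w) (point 1 y) (a := 1) (b := 1)
    (c := d) (by norm_num) (by norm_num) hd (by linarith)
    (by simp [point]; ring)
    (by
      rw [point_snd _ ha, point_snd _ hb, point_snd _ hw, point_snd _ hy]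
      linarith)
  simp only [column]
  linarith

/-- A supporting plane of slope `σ` at the point `y` of the middle column which is tangent to the
outer columns at `a` and `b`. -/
def SupportsMiddle {n : ℕ} [NeZero n] (f : Stripe n → ℝ) (y a b : ℕ) (σ : ℝ) : Prop :=
  IsSubgradient n (column f 1) y σ ∧ IsSubgradient n (column f 0) a σ ∧
    IsSubgradient n (column f 2) b σ ∧
    2 * (column f 1 y - σ * y) ≤ column f 0 a - σ * a + (column f 2 b - σ * b)

/-- For a convex function, one of three candidates always gives a supporting plane at the point `y`
of the middle column. -/
theorem IsConvex.exists_supportsMiddle {n : ℕ} [NeZero n] {f : Stripe n → ℝ} (hf : IsConvex f)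
    {y a b a₁ b₁ a₂ b₂ : ℕ} (hy : y < n) (ha : a < n) (hb : b < n) (ha₁ : a₁ < n) (hb₁ : b₁ < n)
    (ha₂ : a₂ < n) (hb₂ : b₂ < n) (hab : a + b = 2 * y)
    (opt : ∀ s t, s + t = a + b → s < n → t < n →
      column f 0 a + column f 2 b ≤ column f 0 s + column f 2 t) {σ₁ σ₂ : ℝ}
    (hσ₁ : σ₁ = column f 1 (y + 1) - column f 1 y) (hσ₂ : σ₂ = column f 1 y - column f 1 (y - 1))
    (h₁ : IsSubgradient n (column f 0) a₁ σ₁) (h₁' : IsSubgradient n (column f 2) b₁ σ₁)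
    (h₂ : IsSubgradient n (column f 0) a₂ σ₂) (h₂' : IsSubgradient n (column f 2) b₂ σ₂) :
    (∃ σ, SupportsMiddle f y a b σ) ∨ SupportsMiddle f y a₁ b₁ σ₁ ∨
      SupportsMiddle f y a₂ b₂ σ₂ := by
  have hc := hf.seqConvex
  have cy : 0 < y → y + 1 < n →
      column f 1 y - column f 1 (y - 1) ≤ column f 1 (y + 1) - column f 1 y := by
    intro h0 h1
    have := hc 1 (y - 1) y (y + 1) (by omega) (by omega) h1
    rw [Nat.cast_sub (by omega)] at this
    push_cast at this
    linarith
  by_cases hA : y + 1 < n ∧ a₁ + b₁ ≤ 2 * y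
  -- The midpoint of the two tangent points is not above `y`, so `y` is a convex combination of them
  -- and of `y + 1`, where the line of slope `σ₁` through `y` is exact.
  · refine Or.inr (Or.inl ⟨?_, h₁, h₁', ?_⟩)
    · exact (hc 1).isSubgradient hy (fun h0 => hσ₁ ▸ cy h0 hA.1) fun _ => hσ₁.le
    · have hd : (a₁ : ℝ) + b₁ ≤ 2 * y := by exact_mod_cast hA.2
      have := hf.middle_le ha₁ hb₁ hA.1 hy (d := 2 * y - (a₁ + b₁)) (by linarith)
        (by push_cast; ring)
      rw [hσ₁]
      linarith
  by_cases hB : 0 < y ∧ 2 * y ≤ a₂ + b₂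
  · refine Or.inr (Or.inr ⟨?_, h₂, h₂', ?_⟩)
    · exact (hc 1).isSubgradient hy (fun _ => hσ₂.ge) fun h0 => hσ₂ ▸ cy hB.1 h0
    · have hd : 2 * (y : ℝ) ≤ a₂ + b₂ := by exact_mod_cast hB.2
      have := hf.middle_le ha₂ hb₂ (w := y - 1) (by omega) hy (d := (a₂ + b₂) - 2 * y)
        (by linarith) (by rw [Nat.cast_sub (by omega)]; push_cast; ring)
      rw [hσ₂]
      linarith
  -- The remaining tangent points lie on the wrong sides: those for `σ₁` sum to more than `2 y`,
  -- those for `σ₂` to less. Hence the one-sided slopes at the optimal splitting are compatible with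
  -- those at `y`, and there is a common subgradient.
  left
  have opt' : ∀ s t, s + t = b + a → s < n → t < n →
      column f 2 b + column f 0 a ≤ column f 2 s + column f 0 t := by
    intro s t hst hs ht
    have := opt t s (by omega) ht hs
    linarith
  have self : ∀ i t, 0 < t → t + 1 < n →
      column f i t - column f i (t - 1) ≤ column f i (t + 1) - column f i t := by
    intro i t h0 h1
    have := hc i (t - 1) t (t + 1) (by omega) (by omega) h1
    rw [Nat.cast_sub (by omega)] at this
    push_cast at this
    linarith
  have hA' : y + 1 < n → a + b < a₁ + b₁ := by omega
  have hB' : 0 < y → a₂ + b₂ < a + b := by omega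
  obtain ⟨σ, hσ⟩ := exists_common_isSubgradient (column f) hc ![a, y, b]
    (by intro i; fin_cases i <;> simpa) (by
      intro i j hi hj
      fin_cases i <;> fin_cases j <;> simp [-tsub_le_iff_right] at hi hj ⊢
      · exact self 0 a hi hj
      · rw [← hσ₁]
        exact left_slope_le (hc 0) (hc 2) ha ha₁ hb₁ opt h₁ h₁' (hA' hj) hi
      · have := opt (a - 1) (b + 1) (by omega) (by omega) hj
        linarith
      · rw [← hσ₂]
        exact le_right_slope (hc 0) (hc 2) hb opt h₂ h₂' (hB' hi) hj
      · exact self 1 y hi hj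
      · rw [← hσ₂]
        exact le_right_slope (hc 2) (hc 0) ha opt' h₂' h₂ (by have := hB' hi; omega) hj
      · have := opt (a + 1) (b - 1) (by omega) hj (by omega)
        linarith
      · rw [← hσ₁]
        exact left_slope_le (hc 2) (hc 0) hb hb₁ ha₁ opt' h₁' h₁ (by have := hA' hj; omega) hi
      · exact self 2 b hi hj)
  refine ⟨σ, hσ 1, hσ 0, hσ 2, ?_⟩
  have hab' : (a : ℝ) + b = 2 * y := by exact_mod_cast hab
  have := hf.middle_le ha hb hy hy (d := 0) le_rfl (by linarith)
  have h2 : σ * a + σ * b = 2 * (σ * y) := by rw [← mul_add, hab']; ring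
  linarith

/-! ### Extension from a subset -/

/-- A function that has supporting planes on a set `S` agrees on `S` with a convex function. -/
theorem exists_isConvex_of_support {n : ℕ} (f : Stripe n → ℝ) (S : Set (Stripe n))
    (H : ∀ z ∈ S, ∃ α β γ : ℝ, f z = α * (z.1 : ℕ) + β * (z.2 : ℕ) + γ ∧
      ∀ x ∈ S, α * (x.1 : ℕ) + β * (x.2 : ℕ) + γ ≤ f x) :
    ∃ h : Stripe n → ℝ, IsConvex h ∧ ∀ x ∈ S, h x = f x := by
  classical
  choose! α β γ h₁ h₂ using H
  by_cases hS : S.toFinset.Nonempty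
  · refine ⟨fun x => S.toFinset.sup' hS fun z => α z * (x.1 : ℕ) + β z * (x.2 : ℕ) + γ z,
      isConvex_of_support fun x => ?_, fun x hx => le_antisymm ?_ ?_⟩
    · obtain ⟨z, hz, hzx⟩ := S.toFinset.exists_mem_eq_sup' hS
        fun z => α z * (x.1 : ℕ) + β z * (x.2 : ℕ) + γ z
      exact ⟨α z, β z, γ z, hzx.le, fun w => Finset.le_sup'
        (fun z => α z * (w.1 : ℕ) + β z * (w.2 : ℕ) + γ z) hz⟩
    · exact Finset.sup'_le _ _ fun z hz => h₂ z (Set.mem_toFinset.1 hz) x hx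
    · conv_lhs => rw [h₁ x hx]
      exact Finset.le_sup' (fun z => α z * (x.1 : ℕ) + β z * (x.2 : ℕ) + γ z)
        (Set.mem_toFinset.2 hx)
  · refine ⟨fun _ => 0, isConvex_of_support fun z => ⟨0, 0, 0, by simp, by simp⟩, fun x hx => ?_⟩
    exact absurd ⟨x, Set.mem_toFinset.2 hx⟩ hS

/-- A steep plane through a line below an outer column stays below the other columns. -/
theorem exists_steep_plane {n : ℕ} (f : Stripe n → ℝ) (S : Set (Stripe n)) (i : Fin 3) (e c σ : ℝ)
    (he : ∀ j : Fin 3, j ≠ i → 1 ≤ e * ((j : ℕ) - (i : ℕ)))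
    (h : ∀ x ∈ S, x.1 = i → c + σ * (x.2 : ℕ) ≤ f x) :
    ∃ α γ : ℝ, (∀ t : ℝ, α * (i : ℕ) + σ * t + γ = c + σ * t) ∧
      ∀ x ∈ S, α * (x.1 : ℕ) + σ * (x.2 : ℕ) + γ ≤ f x := by
  -- `M` bounds the excess of the line over `f` at every point, so descending by `M` per column
  -- suffices.
  set M : ℝ := ∑ x : Stripe n, |c + σ * (x.2 : ℕ) - f x| with hM
  have hM0 : 0 ≤ M := Finset.sum_nonneg fun _ _ => abs_nonneg _
  refine ⟨-(M * e), c + M * e * (i : ℕ), fun t => by ring, fun x hx => ?_⟩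
  by_cases hi : x.1 = i
  · have := h x hx hi
    rw [hi]
    linarith
  · have h1 : |c + σ * (x.2 : ℕ) - f x| ≤ M :=
      Finset.single_le_sum (f := fun x : Stripe n => |c + σ * (x.2 : ℕ) - f x|)
        (fun _ _ => abs_nonneg _) (Finset.mem_univ x)
    have h2 := (le_abs_self _).trans h1
    have h3 := mul_le_mul_of_nonneg_left (he x.1 hi) hM0
    linarith

/-! ### Deterministic query procedures -/

/-- A deterministic adaptive query procedure that computes an element of `α`. -/
inductive Procedure (X α : Type) : Type
  | pure (a : α) : Procedure X α
  | query (x : X) (next : ℝ → Procedure X α) : Procedure X α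

namespace Procedure

variable {X α β : Type}

/-- Sequential composition. -/
def bind : Procedure X α → (α → Procedure X β) → Procedure X β
  | pure a, k => k a
  | query x next, k => query x fun v => bind (next v) k

/-- The result for the function `f`. -/
def value (f : X → ℝ) : Procedure X α → α
  | pure a => a
  | query x next => value f (next (f x))

/-- The points queried when the function is `f`. -/
def trace (f : X → ℝ) : Procedure X α → List X
  | pure _ => []
  | query x next => x :: trace f (next (f x))

/-- The procedure makes at most the given number of queries. -/
def CostLE : Procedure X α → ℕ → Prop
  | pure _, _ => True
  | query _ _, 0 => False
  | query _ next, d + 1 => ∀ v, CostLE (next v) d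

/-- Run the procedure, recording its queries and their answers, and continue with the record. -/
def toAlgorithm : Procedure X α → List (X × ℝ) → (List (X × ℝ) → Algorithm X) → Algorithm X
  | pure _, r, k => k r
  | query x next, r, k => .query x fun v => toAlgorithm (next v) ((x, v) :: r) k

theorem value_bind (f : X → ℝ) (p : Procedure X α) (k : α → Procedure X β) :
    (p.bind k).value f = (k (p.value f)).value f := by
  induction p with
  | pure a => rfl
  | query x next ih => exact ih (f x)

theorem trace_bind (f : X → ℝ) (p : Procedure X α) (k : α → Procedure X β) :
    (p.bind k).trace f = p.trace f ++ (k (p.value f)).trace f := by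
  induction p with
  | pure a => rfl
  | query x next ih => exact congrArg (x :: ·) (ih (f x))

/-- An adaptive procedure sees only the answers. So an inspection of `f` that fits a convex `h` is
also the inspection of `h`, whose guarantees then apply. -/
theorem trace_congr {f g : X → ℝ} (p : Procedure X α) (h : ∀ x ∈ p.trace f, g x = f x) :
    p.trace g = p.trace f := by
  induction p with
  | pure a => rfl
  | query x next ih =>
    have hx : g x = f x := h x (by simp [trace])
    simp only [trace, hx]
    rw [ih (f x) fun y hy => h y (by simp [trace, hy])]

theorem CostLE.mono {p : Procedure X α} {d e : ℕ} (h : p.CostLE d) (hde : d ≤ e) :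
    p.CostLE e := by
  induction p generalizing d e with
  | pure a => trivial
  | query x next ih =>
    cases d with
    | zero => exact h.elim
    | succ d =>
      cases e with
      | zero => omega
      | succ e => exact fun v => ih v (h v) (by omega)

theorem CostLE.bind {p : Procedure X α} {k : α → Procedure X β} {d e : ℕ} (hp : p.CostLE d)
    (hk : ∀ a, (k a).CostLE e) : (p.bind k).CostLE (d + e) := by
  induction p generalizing d with
  | pure a => exact (hk a).mono (by omega)
  | query x next ih =>
    cases d with
    | zero => exact hp.elim
    | succ d =>
      rw [Nat.add_right_comm]
      exact fun v => ih v (hp v)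

theorem run_toAlgorithm (D : PMF X) (f : X → ℝ) (p : Procedure X α) (r : List (X × ℝ))
    (k : List (X × ℝ) → Algorithm X) :
    (p.toAlgorithm r k).run D f =
      (k ((p.trace f).reverse.map (fun x => (x, f x)) ++ r)).run D f := by
  induction p generalizing r with
  | pure a => rfl
  | query x next ih =>
    simp only [toAlgorithm, Algorithm.run, trace]
    rw [ih]
    simp

theorem queries_toAlgorithm_le {p : Procedure X α} {d : ℕ} (hp : p.CostLE d) (r : List (X × ℝ))
    {k : List (X × ℝ) → Algorithm X} {c : ℕ∞} (hk : ∀ r, (k r).queries ≤ c) :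
    (p.toAlgorithm r k).queries ≤ d + c := by
  induction p generalizing r d with
  | pure a => exact (hk r).trans le_add_self
  | query x next ih =>
    cases d with
    | zero => exact hp.elim
    | succ d =>
      simp only [toAlgorithm, Algorithm.queries]
      push_cast
      rw [add_comm (d : ℕ∞) 1, add_assoc]
      gcongr
      exact iSup_le fun v => ih v (hp v) _

theorem samples_toAlgorithm_le (p : Procedure X α) (r : List (X × ℝ))
    {k : List (X × ℝ) → Algorithm X} {c : ℕ∞} (hk : ∀ r, (k r).samples ≤ c) :
    (p.toAlgorithm r k).samples ≤ c := by
  induction p generalizing r with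
  | pure a => exact hk r
  | query x next ih => exact iSup_le fun v => ih v _

/-- Query all points of a list. -/
def readAll : List X → Procedure X Unit
  | [] => pure ()
  | x :: l => query x fun _ => readAll l

theorem trace_readAll (f : X → ℝ) (l : List X) : (readAll l).trace f = l := by
  induction l with
  | nil => rfl
  | cons x l ih => simp [readAll, trace, ih]

theorem costLE_readAll (l : List X) : (readAll l).CostLE l.length := by
  induction l with
  | nil => trivial
  | cons x l ih => exact fun _ => ih

/-- Binary search for a minimum on `{lo, …, hi}` of a unimodal sequence, in at most `K` steps. -/
noncomputable def argmin (φ : ℕ → Procedure X ℝ) : ℕ → ℕ → ℕ → Procedure X ℕ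
  | 0, lo, _ => pure lo
  | K + 1, lo, hi =>
    if hi ≤ lo then pure lo
    else
      (φ ((lo + hi) / 2)).bind fun v =>
        (φ ((lo + hi) / 2 + 1)).bind fun w =>
          if v ≤ w then argmin φ K lo ((lo + hi) / 2) else argmin φ K ((lo + hi) / 2 + 1) hi

/-- Comparing two neighbouring values shows which half still contains a minimum; `h₁` and `h₂` are
the two forms of unimodality that justify discarding the other half. -/
theorem argmin_spec {φ : ℕ → Procedure X ℝ} {f : X → ℝ} {v : ℕ → ℝ}
    (hv : ∀ a, (φ a).value f = v a) (K : ℕ) {lo hi : ℕ} (hle : lo ≤ hi) (hK : hi - lo < 2 ^ K)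
    (h₁ : ∀ m x, lo ≤ m → m < x → x ≤ hi → v m ≤ v (m + 1) → v m ≤ v x)
    (h₂ : ∀ m x, lo ≤ x → x ≤ m → m + 1 ≤ hi → v (m + 1) ≤ v m → v (m + 1) ≤ v x) :
    lo ≤ (argmin φ K lo hi).value f ∧ (argmin φ K lo hi).value f ≤ hi ∧
      ∀ x, lo ≤ x → x ≤ hi → v ((argmin φ K lo hi).value f) ≤ v x := by
  induction K generalizing lo hi with
  | zero =>
    have : hi = lo := by simp at hK; omega
    subst this
    refine ⟨le_rfl, le_rfl, fun x hx hx' => ?_⟩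
    have : x = hi := by omega
    rw [this]
    rfl
  | succ K ih =>
    rw [argmin]
    split_ifs with hlo
    · have : hi = lo := by omega
      subst this
      refine ⟨le_rfl, le_rfl, fun x hx hx' => ?_⟩
      have : x = hi := by omega
      rw [this]
      rfl
    · rw [value_bind, value_bind, hv, hv]
      rw [pow_succ] at hK
      set m := (lo + hi) / 2 with hm
      split_ifs with hc
      · obtain ⟨a1, a2, a3⟩ := ih (lo := lo) (hi := m) (by omega) (by omega)
          (fun k x e1 e2 e3 => h₁ k x e1 e2 (by omega))
          (fun k x e1 e2 e3 => h₂ k x e1 e2 (by omega))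
        refine ⟨a1, by omega, fun x hx hx' => ?_⟩
        by_cases hxm : x ≤ m
        · exact a3 x hx hxm
        · exact (a3 m (by omega) le_rfl).trans (h₁ m x (by omega) (by omega) hx' hc)
      · obtain ⟨a1, a2, a3⟩ := ih (lo := m + 1) (hi := hi) (by omega) (by omega)
          (fun k x e1 e2 e3 => h₁ k x (by omega) e2 e3)
          (fun k x e1 e2 e3 => h₂ k x (by omega) e2 e3)
        refine ⟨by omega, a2, fun x hx hx' => ?_⟩
        by_cases hxm : x ≤ m
        · exact (a3 (m + 1) le_rfl (by omega)).trans
            (h₂ m x hx hxm (by omega) (le_of_not_ge hc))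
        · exact a3 x (by omega) hx'

theorem costLE_argmin {φ : ℕ → Procedure X ℝ} {c : ℕ} (hφ : ∀ a, (φ a).CostLE c) (K lo hi : ℕ) :
    (argmin φ K lo hi).CostLE (2 * c * K) := by
  induction K generalizing lo hi with
  | zero => trivial
  | succ K ih =>
    rw [argmin]
    split_ifs
    · trivial
    · refine ((hφ _).bind fun v => (hφ _).bind fun w => (?_ : CostLE _ (2 * c * K))).mono
        (by linarith)
      split_ifs <;> exact ih _ _

end Procedure

/-! ### Inspecting a point of the stripe -/

section Inspect

open Procedure

variable {n : ℕ} [NeZero n]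

/-- Query one point. -/
def read (i : Fin 3) (t : ℕ) : Procedure (Stripe n) ℝ := .query (point i t) .pure

/-- Query the anchors of a point. -/
def probe (K : ℕ) (i : Fin 3) (t : ℕ) : Procedure (Stripe n) Unit :=
  readAll ((anchors K t).map (point i))

theorem mem_trace_probe (f : Stripe n → ℝ) {K t s : ℕ} (i : Fin 3) (hs : s ∈ anchors K t) :
    point i s ∈ (probe K i t).trace f := by
  rw [probe, trace_readAll]
  exact List.mem_map_of_mem hs

theorem costLE_probe (K : ℕ) (i : Fin 3) (t : ℕ) :
    (probe K i t : Procedure (Stripe n) Unit).CostLE (4 * K) := by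
  have := costLE_readAll ((anchors K t).map (point i : ℕ → Stripe n))
  rwa [List.length_map, length_anchors] at this

/-- Find the point where a line of slope `σ` is tangent to a column. -/
noncomputable def tangentPoint (K : ℕ) (i : Fin 3) (σ : ℝ) : Procedure (Stripe n) ℕ :=
  argmin (fun a => (read i a).bind fun v => .pure (v - σ * a)) K 0 (n - 1)

theorem costLE_tangentPoint (K : ℕ) (i : Fin 3) (σ : ℝ) :
    (tangentPoint K i σ : Procedure (Stripe n) ℕ).CostLE (2 * K) := by
  refine costLE_argmin (c := 1) ?_ K _ _
  exact fun _ _ => trivial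

theorem tangentPoint_spec {f : Stripe n → ℝ} (hf : IsConvex f) {K : ℕ} (hK : n ≤ 2 ^ K)
    (i : Fin 3) (σ : ℝ) : (tangentPoint K i σ).value f < n ∧
      IsSubgradient n (column f i) ((tangentPoint K i σ).value f) σ := by
  have hn := NeZero.pos n
  have hc := (hf.seqConvex i).sub_linear σ
  obtain ⟨-, h2, h3⟩ := argmin_spec (f := f) (v := fun a => column f i a - σ * a)
    (φ := fun a => (read i a).bind fun v => .pure (v - σ * a)) (fun a => rfl) K
    (Nat.zero_le (n - 1)) (by omega)
    (fun m x _ e2 e3 e4 => hc.le_of_le_succ e4 e2 (by omega))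
    (fun m x _ e2 e3 e4 => hc.le_of_succ_le e4 e2 (by omega))
  refine ⟨by unfold tangentPoint; omega, fun x hx => ?_⟩
  have := h3 x (Nat.zero_le _) (by omega)
  unfold tangentPoint
  linarith

/-- Find and probe the points where lines of slope `σ` are tangent to the outer columns. -/
noncomputable def probeTangents (K : ℕ) (σ : ℝ) : Procedure (Stripe n) Unit :=
  (tangentPoint K 0 σ).bind fun a => (probe K 0 a).bind fun _ =>
    (tangentPoint K 2 σ).bind fun b => probe K 2 b

theorem costLE_probeTangents (K : ℕ) (σ : ℝ) :
    (probeTangents K σ : Procedure (Stripe n) Unit).CostLE (12 * K) :=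
  ((costLE_tangentPoint K 0 σ).bind fun _ => (costLE_probe K 0 _).bind fun _ =>
    (costLE_tangentPoint K 2 σ).bind fun _ => costLE_probe K 2 _).mono (by omega)

/-- The trace of a procedure contains the anchors of the points `a` and `b` of the outer columns. -/
def Probes (K : ℕ) (l : List (Stripe n)) (a b : ℕ) : Prop :=
  (∀ s ∈ anchors K a, point 0 s ∈ l) ∧ ∀ s ∈ anchors K b, point 2 s ∈ l

theorem Probes.mono {K : ℕ} {l l' : List (Stripe n)} {a b : ℕ} (h : Probes K l a b)
    (hl : l ⊆ l') : Probes K l' a b :=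
  ⟨fun s hs => hl (h.1 s hs), fun s hs => hl (h.2 s hs)⟩

theorem probes_probeTangents (f : Stripe n → ℝ) (K : ℕ) (σ : ℝ) :
    Probes K ((probeTangents K σ).trace f) ((tangentPoint K 0 σ).value f)
      ((tangentPoint K 2 σ).value f) := by
  constructor <;> intro s hs <;>
    simp only [probeTangents, trace_bind, List.mem_append, mem_trace_probe f _ hs,
      true_or, or_true]

/-- Find a splitting of `2 y` as `a + b` that minimizes the sum of the values of the outer columns
at `a` and `b`. -/
noncomputable def splitting (K y : ℕ) : Procedure (Stripe n) ℕ :=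
  argmin (fun a => (read 0 a).bind fun v => (read 2 (2 * y - a)).bind fun w => .pure (v + w)) K
    (2 * y - (n - 1)) (min (n - 1) (2 * y))

theorem costLE_splitting (K y : ℕ) :
    (splitting K y : Procedure (Stripe n) ℕ).CostLE (4 * K) := by
  refine costLE_argmin (c := 2) ?_ K _ _
  exact fun _ _ _ => trivial

/-- The sum of one column and the reflection of the other is convex in `a`, hence unimodal. The
search range keeps both `a` and `2 y - a` in the stripe. -/
theorem splitting_spec {f : Stripe n → ℝ} (hf : IsConvex f) {K y : ℕ} (hK : n ≤ 2 ^ K)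
    (hy : y < n) :
    (splitting K y).value f < n ∧ (splitting K y).value f ≤ 2 * y ∧
      2 * y - (splitting K y).value f < n ∧
      ∀ s t, s + t = 2 * y → s < n → t < n →
        column f 0 ((splitting K y).value f) + column f 2 (2 * y - (splitting K y).value f) ≤
          column f 0 s + column f 2 t := by
  have hn := NeZero.pos n
  have c0 := hf.seqConvex 0
  have c2 := hf.seqConvex 2
  obtain ⟨h1, h2, h3⟩ := argmin_spec (f := f)
    (v := fun a => column f 0 a + column f 2 (2 * y - a))
    (φ := fun a => (read 0 a).bind fun v => (read 2 (2 * y - a)).bind fun w => .pure (v + w))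
    (fun a => rfl) K (lo := 2 * y - (n - 1)) (hi := min (n - 1) (2 * y)) (by omega) (by omega)
    (fun m x e1 e2 e3 e4 => by
      have d0 := c0 m (m + 1) x (by omega) (by omega) (by omega)
      have d2 := c2 (2 * y - x) (2 * y - (m + 1)) (2 * y - m) (by omega) (by omega) (by omega)
      rw [Nat.cast_sub (by omega), Nat.cast_sub (by omega), Nat.cast_sub (by omega)] at d2
      have : (m : ℝ) < x := by exact_mod_cast e2
      push_cast at d0 d2
      nlinarith)
    (fun m x e1 e2 e3 e4 => by
      have d0 := c0 x m (m + 1) (by omega) (by omega) (by omega)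
      have d2 := c2 (2 * y - (m + 1)) (2 * y - m) (2 * y - x) (by omega) (by omega) (by omega)
      rw [Nat.cast_sub (by omega), Nat.cast_sub (by omega), Nat.cast_sub (by omega)] at d2
      have : (x : ℝ) ≤ m := by exact_mod_cast e2
      push_cast at d0 d2
      nlinarith)
  unfold splitting
  refine ⟨by omega, by omega, by omega, fun s t hst hs ht => ?_⟩
  have := h3 s (by omega) (by omega)
  rwa [show 2 * y - s = t by omega] at this

/-- Query enough points to find a supporting plane at the point `y` of the middle column. -/
noncomputable def inspectMiddle (K y : ℕ) : Procedure (Stripe n) Unit :=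
  (splitting K y).bind fun a => (probe K 0 a).bind fun _ => (probe K 2 (2 * y - a)).bind fun _ =>
    (read 1 (y - 1)).bind fun u => (read 1 y).bind fun v => (read 1 (y + 1)).bind fun w =>
      (probeTangents K (w - v)).bind fun _ => probeTangents K (v - u)

theorem costLE_inspectMiddle (K y : ℕ) :
    (inspectMiddle K y : Procedure (Stripe n) Unit).CostLE (36 * K + 3) := by
  have hr : ∀ t, (read 1 t : Procedure (Stripe n) ℝ).CostLE 1 := fun t _ => trivial
  exact ((costLE_splitting K y).bind fun _ => (costLE_probe K 0 _).bind fun _ =>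
    (costLE_probe K 2 _).bind fun _ => (hr _).bind fun _ => (hr _).bind fun _ => (hr _).bind fun _ =>
      (costLE_probeTangents K _).bind fun _ => costLE_probeTangents K _).mono (by omega)

/-- The anchors of all three candidates are read, so the procedure need not know which one supports.
-/
theorem inspectMiddle_spec {f : Stripe n → ℝ} (hf : IsConvex f) {K y : ℕ} (hK : n ≤ 2 ^ K)
    (hy : y < n) : ∃ a b σ, a < n ∧ b < n ∧ SupportsMiddle f y a b σ ∧
      Probes K ((inspectMiddle K y).trace f) a b := by
  obtain ⟨p1, p2, p3, opt⟩ := splitting_spec hf hK hy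
  set a := (splitting K y).value f with ha
  have t1 := tangentPoint_spec hf hK 0 (column f 1 (y + 1) - column f 1 y)
  have t2 := tangentPoint_spec hf hK 2 (column f 1 (y + 1) - column f 1 y)
  have t3 := tangentPoint_spec hf hK 0 (column f 1 y - column f 1 (y - 1))
  have t4 := tangentPoint_spec hf hK 2 (column f 1 y - column f 1 (y - 1))
  have q1 := probes_probeTangents f K (column f 1 (y + 1) - column f 1 y)
  have q2 := probes_probeTangents f K (column f 1 y - column f 1 (y - 1))
  have htr : (inspectMiddle K y).trace f = (splitting K y).trace f ++ ((probe K 0 a).trace f ++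
      ((probe K 2 (2 * y - a)).trace f ++ (point 1 (y - 1) :: point 1 y :: point 1 (y + 1) ::
        ((probeTangents K (column f 1 (y + 1) - column f 1 y)).trace f ++
          (probeTangents K (column f 1 y - column f 1 (y - 1))).trace f)))) := by
    simp only [inspectMiddle, trace_bind]
    rfl
  have q0 : Probes K ((inspectMiddle K y).trace f) a (2 * y - a) := by
    rw [htr]
    constructor <;> intro s hs <;>
      simp only [List.mem_append, mem_trace_probe f _ hs, true_or, or_true]
  rcases hf.exists_supportsMiddle hy p1 p3 t1.1 t2.1 t3.1 t4.1 (by omega)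
    (fun s t hst => opt s t (by omega)) rfl rfl t1.2 t2.2 t3.2 t4.2 with ⟨σ, h⟩ | h | h
  · exact ⟨_, _, σ, p1, p3, h, q0⟩
  · refine ⟨_, _, _, t1.1, t2.1, h, q1.mono ?_⟩
    rw [htr]
    intro x hx
    simp [hx]
  · refine ⟨_, _, _, t3.1, t4.1, h, q2.mono ?_⟩
    rw [htr]
    intro x hx
    simp [hx]

/-- Query enough points to find a supporting plane at a point of the stripe. -/
noncomputable def inspect (K : ℕ) (x : Stripe n) : Procedure (Stripe n) Unit :=
  (probe K x.1 x.2).bind fun _ => if x.1 = 1 then inspectMiddle K x.2 else .pure ()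

theorem costLE_inspect {K : ℕ} (hK : 0 < K) (x : Stripe n) : (inspect K x).CostLE (43 * K) := by
  refine ((costLE_probe K _ _).bind fun _ => (?_ : CostLE _ (36 * K + 3))).mono (by omega)
  split_ifs
  · exact costLE_inspectMiddle K _
  · trivial

/-- The queries of the inspection of `x` do not show that `f` is not convex. -/
def Passes (K : ℕ) (f : Stripe n → ℝ) (x : Stripe n) : Prop :=
  ∃ h : Stripe n → ℝ, IsConvex h ∧ ∀ y ∈ (inspect K x).trace f, h y = f y

/-- On the points that pass the inspection, `f` agrees with a convex function. -/
theorem exists_isConvex_eq_of_passes {K : ℕ} (hK0 : 0 < K) (hK : n ≤ 2 ^ K) (f : Stripe n → ℝ) :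
    ∃ h : Stripe n → ℝ, IsConvex h ∧ ∀ x, Passes K f x → h x = f x := by
  refine exists_isConvex_of_support f {x | Passes K f x} fun z hz => ?_
  have agree : ∀ x : Stripe n, Passes K f x → ∃ g, SeqConvex n g ∧
      ∀ s ∈ anchors K x.2, column f x.1 s = g s := by
    rintro x ⟨h, hh, hx⟩
    refine ⟨column h x.1, hh.seqConvex _, fun s hs => (hx _ ?_).symm⟩
    rw [inspect, trace_bind]
    exact List.mem_append_left _ (mem_trace_probe f _ hs)
  -- The tangent point `t` need not pass itself: it is enough that `f` fits a convex sequence on its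
  -- anchors.
  have below : ∀ (i : Fin 3) (t : ℕ) (g : ℕ → ℝ) (σ : ℝ), t < n → SeqConvex n g →
      (∀ s ∈ anchors K t, column f i s = g s) → IsSubgradient n g t σ →
      ∀ x : Stripe n, Passes K f x → x.1 = i → column f i t + σ * ((x.2 : ℕ) - t) ≤ f x := by
    rintro i t g σ ht hg hfg hσ x hx rfl
    obtain ⟨g', hg', hfg'⟩ := agree x hx
    have := le_of_agree_anchors hK ht x.2.2 hg hg' hfg hfg' hσ
    rwa [column_val] at this
  have outer : ∀ e : ℝ, (∀ j : Fin 3, j ≠ z.1 → 1 ≤ e * ((j : ℕ) - (z.1 : ℕ))) →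
      ∃ α β γ : ℝ, f z = α * (z.1 : ℕ) + β * (z.2 : ℕ) + γ ∧
        ∀ x ∈ {x | Passes K f x}, α * (x.1 : ℕ) + β * (x.2 : ℕ) + γ ≤ f x := by
    intro e he
    obtain ⟨g, hg, hfg⟩ := agree z hz
    obtain ⟨σ, hσ⟩ := hg.exists_isSubgradient z.2.2
    obtain ⟨α, γ, h1, h2⟩ := exists_steep_plane f {x | Passes K f x} z.1 e
      (f z - σ * (z.2 : ℕ)) σ he fun x hx hxi => by
        have := below z.1 z.2 g σ z.2.2 hg hfg hσ x hx hxi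
        rw [column_val] at this
        linarith
    exact ⟨α, σ, γ, by rw [h1]; ring, h2⟩
  obtain ⟨i, y⟩ := z
  fin_cases i
  · refine outer 1 fun j hj => ?_
    fin_cases j <;> simp at hj ⊢
  · obtain ⟨h, hh, hzh⟩ := hz
    have htr := trace_congr _ hzh
    rw [← htr] at hzh
    have hsub : (inspectMiddle K y).trace h ⊆ (inspect K ((1 : Fin 3), y)).trace h := by
      rw [inspect, trace_bind, if_pos rfl]
      exact List.subset_append_right _ _
    have hprobe : ∀ s ∈ anchors K y, column f 1 s = column h 1 s := by
      intro s hs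
      refine (hzh _ ?_).symm
      rw [inspect, trace_bind]
      exact List.mem_append_left _ (mem_trace_probe h 1 hs)
    obtain ⟨a, b, σ, ha, hb, ⟨s1, s0, s2, hle⟩, pa, pb⟩ := inspectMiddle_spec hh hK y.2
    have ea : ∀ s ∈ anchors K a, column f 0 s = column h 0 s :=
      fun s hs => (hzh _ (hsub (pa s hs))).symm
    have eb : ∀ s ∈ anchors K b, column f 2 s = column h 2 s :=
      fun s hs => (hzh _ (hsub (pb s hs))).symm
    have b0 := below 0 a _ σ ha (hh.seqConvex 0) ea s0
    have b1 := below 1 y _ σ y.2 (hh.seqConvex 1) hprobe s1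
    have b2 := below 2 b _ σ hb (hh.seqConvex 2) eb s2
    rw [← ea a (self_mem_anchors hK0), ← eb b (self_mem_anchors hK0),
      ← hprobe y (self_mem_anchors hK0)] at hle
    have e1 : column f 1 (y : ℕ) = f (1, y) := column_val f (1, y)
    rw [e1] at hle b1
    -- The plane is the tangent line in columns `0` and `1`. Its intercept in column `2` is then at
    -- most that of the tangent line there, by the last condition of `SupportsMiddle`.
    refine ⟨f (1, y) - σ * (y : ℕ) - (column f 0 a - σ * a), σ, column f 0 a - σ * a,
      by simp; ring, fun x hx => ?_⟩
    obtain ⟨i, t⟩ := x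
    fin_cases i
    · have := b0 _ hx rfl
      simp at this ⊢
      linarith
    · have := b1 _ hx rfl
      simp at this ⊢
      linarith
    · have := b2 _ hx rfl
      simp at this ⊢
      linarith
  · refine outer (-1) fun j hj => ?_
    fin_cases j <;> simp at hj ⊢
    norm_num

end Inspect

/-! ### The tester -/

/-- A record of queries and answers is consistent with a convex function. -/
def Consistent {n : ℕ} (r : List (Stripe n × ℝ)) : Prop :=
  ∃ h : Stripe n → ℝ, IsConvex h ∧ ∀ p ∈ r, h p.1 = p.2

open Classical in
/-- Inspect `s` samples, and reject if one of the inspections shows that the function is not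
convex. -/
noncomputable def tester {n : ℕ} [NeZero n] (K : ℕ) : ℕ → Algorithm (Stripe n)
  | 0 => .output true
  | s + 1 => .sample fun x => (inspect K x).toAlgorithm [] fun r =>
      if Consistent r then tester K s else .output false

theorem queries_tester_le {n : ℕ} [NeZero n] {K : ℕ} (hK : 0 < K) (s : ℕ) :
    (tester K s : Algorithm (Stripe n)).queries ≤ (s * (43 * K) : ℕ) := by
  induction s with
  | zero => simp [tester, Algorithm.queries]
  | succ s ih =>
    refine iSup_le fun x => (Procedure.queries_toAlgorithm_le (costLE_inspect hK x) []
      (c := (s * (43 * K) : ℕ)) fun r => ?_).trans ?_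
    · split_ifs
      · exact ih
      · simp [Algorithm.queries]
    · rw [← Nat.cast_add, Nat.cast_le]
      linarith

theorem samples_tester_le {n : ℕ} [NeZero n] (K s : ℕ) :
    (tester K s : Algorithm (Stripe n)).samples ≤ s := by
  induction s with
  | zero => simp [tester, Algorithm.samples]
  | succ s ih =>
    simp only [tester, Algorithm.samples]
    push_cast
    rw [add_comm]
    gcongr
    refine iSup_le fun x => Procedure.samples_toAlgorithm_le _ _ fun r => ?_
    split_ifs
    · exact ih
    · simp [Algorithm.samples]

/-- Inspections are deterministic, so a round succeeds exactly when its sample passes, and the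
rounds are independent. -/
theorem run_tester_true {n : ℕ} [NeZero n] (K : ℕ) (D : PMF (Stripe n)) (f : Stripe n → ℝ)
    (s : ℕ) : (tester K s).run D f true = D.toOuterMeasure {x | Passes K f x} ^ s := by
  classical
  induction s with
  | zero => simp [tester, Algorithm.run]
  | succ s ih =>
    simp only [tester, Algorithm.run]
    rw [PMF.bind_apply, pow_succ', ← ih, PMF.toOuterMeasure_apply, ← ENNReal.tsum_mul_right]
    refine tsum_congr fun x => ?_
    rw [Procedure.run_toAlgorithm]
    have hiff : Consistent (((inspect K x).trace f).reverse.map (fun y => (y, f y)) ++ []) ↔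
        Passes K f x := by
      simp only [Consistent, Passes, List.append_nil, List.mem_map, List.mem_reverse,
        forall_exists_index, and_imp, forall_apply_eq_imp_iff₂]
    by_cases hx : Passes K f x
    · rw [if_pos (hiff.2 hx), Set.indicator_of_mem (by exact hx)]
    · rw [if_neg fun h => hx (hiff.1 h), Set.indicator_of_notMem (by exact hx)]
      simp [Algorithm.run]

theorem isOneSidedDistributionFreeTester_tester {n : ℕ} [NeZero n] {K s : ℕ} (hK0 : 0 < K) (hK : n ≤ 2 ^ K)
    {ε : ℝ} (hε : 0 < ε) (hε1 : ε < 1) (hs : 2 / ε ≤ s) :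
    IsOneSidedDistributionFreeTester ε (tester K s : Algorithm (Stripe n)) := by
  intro D
  refine ⟨fun f hf => ?_, fun f hf => ?_⟩
  · rw [run_tester_true, show {x | Passes K f x} = Set.univ from
      Set.eq_univ_of_forall fun x => ⟨f, hf, fun _ _ => rfl⟩]
    rw [(D.toOuterMeasure_apply_eq_one_iff _).2 (Set.subset_univ _), one_pow]
  · obtain ⟨h, hh, hfh⟩ := exists_isConvex_eq_of_passes hK0 hK f
    have h1 := hf h hh
    set S := {x | Passes K f x} with hS
    have h2 : D.toOuterMeasure S + D.toOuterMeasure Sᶜ = 1 := by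
      rw [PMF.toOuterMeasure_apply, PMF.toOuterMeasure_apply, ← ENNReal.tsum_add, ← D.tsum_coe]
      refine tsum_congr fun x => ?_
      by_cases hx : x ∈ S <;> simp [hx]
    have h3 : ENNReal.ofReal ε ≤ D.toOuterMeasure Sᶜ :=
      h1.trans (MeasureTheory.measure_mono fun x hx hxS => hx (hfh x hxS).symm)
    have h4 : D.toOuterMeasure S ≤ ENNReal.ofReal (1 - ε) := by
      rw [ENNReal.ofReal_sub _ hε.le, ENNReal.ofReal_one]
      refine ENNReal.le_sub_of_add_le_right ENNReal.ofReal_ne_top ?_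
      rw [← h2]
      gcongr
    -- `(1 - ε)^s ≤ e^(-ε s) ≤ e^(-2)`, and `e² ≥ 1 + 2`.
    have h5 : (1 - ε) ^ s ≤ 1 / 3 := by
      have e1 : 1 - ε ≤ Real.exp (-ε) := by linarith [Real.add_one_le_exp (-ε)]
      have e2 : (1 - ε) ^ s ≤ Real.exp (-ε) ^ s := pow_le_pow_left₀ (by linarith) e1 _
      rw [← Real.exp_nat_mul] at e2
      have e3 : (s : ℝ) * -ε ≤ -2 := by
        rw [div_le_iff₀ hε] at hs
        linarith
      have e4 : Real.exp (-2) ≤ 1 / 3 := by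
        rw [Real.exp_neg, one_div]
        refine inv_anti₀ (by norm_num) ?_
        linarith [Real.add_one_le_exp 2]
      exact e2.trans ((Real.exp_le_exp.2 e3).trans e4)
    have h6 : (tester K s).run D f true ≤ ENNReal.ofReal (1 / 3) := by
      rw [run_tester_true]
      calc _ ≤ ENNReal.ofReal (1 - ε) ^ s := by gcongr
        _ = ENNReal.ofReal ((1 - ε) ^ s) := (ENNReal.ofReal_pow (by linarith) _).symm
        _ ≤ _ := ENNReal.ofReal_le_ofReal h5
    have h7 := ((tester K s).run D f).tsum_coe
    rw [tsum_fintype, Fintype.sum_bool] at h7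
    have h8 : (2 / 3 : ℝ≥0∞) = ENNReal.ofReal (2 / 3) := by
      rw [ENNReal.ofReal_div_of_pos (by norm_num)]; simp
    have h9 : ENNReal.ofReal (1 / 3) + ENNReal.ofReal (2 / 3) ≤
        ENNReal.ofReal (1 / 3) + (tester K s).run D f false := by
      rw [← ENNReal.ofReal_add (by norm_num) (by norm_num)]
      norm_num
      rw [← h7]
      gcongr
    rw [h8]
    exact (ENNReal.add_le_add_iff_left ENNReal.ofReal_ne_top).1 h9

/-- The tester makes few queries and draws few samples. -/
theorem exists_tester {n : ℕ} (hn : 2 ≤ n) {ε : ℝ} (hε : 0 < ε) (hε1 : ε < 1) :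
    ∃ A : Algorithm (Stripe n), IsOneSidedDistributionFreeTester ε A ∧
      (∃ q : ℕ, A.queries ≤ q ∧ (q : ℝ) ≤ 1032 * (Real.log n) ^ 2 / ε) ∧
      (∃ s : ℕ, A.samples ≤ s ∧ (s : ℝ) ≤ 1032 / ε) := by
  have : NeZero n := ⟨by omega⟩
  set K := Nat.log 2 n + 1 with hKdef
  have hK : n ≤ 2 ^ K := (Nat.lt_pow_succ_log_self (by norm_num) n).le
  set s := ⌈2 / ε⌉₊ with hsdef
  have hs : 2 / ε ≤ s := Nat.le_ceil _
  have hs3 : (s : ℝ) ≤ 3 / ε := by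
    have h1 : (s : ℝ) < 2 / ε + 1 := Nat.ceil_lt_add_one (by positivity)
    have h2 : 1 < 1 / ε := by rw [lt_div_iff₀ hε]; linarith
    have h3 : 3 / ε = 2 / ε + 1 / ε := by ring
    linarith
  have hlog : (1 / 2 : ℝ) ≤ Real.log n := by
    have h1 : Real.log 2 ≤ Real.log n := Real.log_le_log (by norm_num) (by exact_mod_cast hn)
    linarith [Real.log_two_gt_d9]
  have hKlog : (K : ℝ) ≤ 4 * Real.log n := by
    have h1 : (Nat.log 2 n : ℝ) * Real.log 2 ≤ Real.log n := by
      rw [← Real.log_pow]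
      refine Real.log_le_log (by positivity) ?_
      exact_mod_cast Nat.pow_log_le_self 2 (by omega)
    have h2 : (0 : ℝ) ≤ Nat.log 2 n := Nat.cast_nonneg _
    rw [hKdef]
    push_cast
    nlinarith [Real.log_two_gt_d9]
  refine ⟨tester K s, isOneSidedDistributionFreeTester_tester (by omega) hK hε hε1 hs,
    ⟨_, queries_tester_le (by omega) s, ?_⟩, ⟨s, samples_tester_le K s, ?_⟩⟩
  · push_cast
    -- The bound is linear in `log n`; since `log n ≥ 1/2`, doubling the constant turns it into a
    -- bound by `log² n`.
    calc (s : ℝ) * (43 * K) ≤ 3 / ε * (43 * (4 * Real.log n)) := by gcongr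
      _ = 516 * Real.log n / ε := by ring
      _ ≤ 1032 * (Real.log n) ^ 2 / ε := by
        rw [div_le_div_iff_of_pos_right hε]
        nlinarith
  · refine hs3.trans ?_
    gcongr
    norm_num

end ConvexityTesting

theorem theorem1p5 :
    (∃ C : ℝ, 0 < C ∧ ∀ n : ℕ, 2 ≤ n → ∀ ε : ℝ, 0 < ε → ε < 1 →
      ∃ A : ConvexityTesting.Algorithm (ConvexityTesting.Stripe n),
        ConvexityTesting.IsOneSidedDistributionFreeTester ε A ∧
        (∃ q : ℕ, A.queries ≤ q ∧ (q : ℝ) ≤ C * (Real.log n) ^ 2 / ε) ∧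
        (∃ s : ℕ, A.samples ≤ s ∧ (s : ℝ) ≤ C / ε)) ∧
    (∃ c : ℝ, 0 < c ∧ ∀ (n : ℕ) [NeZero n] (ε : ℝ), 0 < ε → ε ≤ 1 / 10 →
      ∀ A : ConvexityTesting.Algorithm (ConvexityTesting.Stripe n),
        A.NonAdaptive → ConvexityTesting.IsTester ε A →
          ∀ q : ℕ, A.queries ≤ q → c * Real.sqrt n ≤ q) := by
  refine ⟨⟨1032, by norm_num, fun n hn ε hε hε1 => ConvexityTesting.exists_tester hn hε hε1⟩,
    ⟨1 / 25, by norm_num, fun n _ ε _ hε A hA hT q hq =>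
      ConvexityTesting.queries_lower_bound hε hA hT hq⟩⟩
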